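/- For a permutation $\pi=\pi_1\cdots\pi_n$ of $\{1,\dots,n\}$ ($n\ge 0$), let $\mathsf{des}(\pi)$ be the number of descents, i.e. of positions $1\le i\le n-1$ with $\pi_i>\pi_{i+1}$; let $\mathsf{xdes}(\pi)$ be the number of crossing descents, i.e. of descents $i$ with $\pi_i\ge i+1\ge\pi_{i+1}$; and let $\mathsf{fix}(\pi)$ be the number of fixed points. Let $K=\mathbb{Z}[[s,r,u]]$ and let $$F(t,s,r;u)=\sum_{n\ge 0}\Bigl(\sum_{\pi\in\mathfrak{S}_n}t^{\mathsf{des}(\pi)}s^{\mathsf{xdes}(\pi)}r^{\mathsf{fix}(\pi)}\Bigr)\frac{u^n}{(1-t)^{n+1}}\in K[[t]].$$ Let $X_i,Y_i,Z_i$ ($i\ge 0$) be commuting variables and let $K[[X,Y,Z]]$ be the ring of formal power series in all of them. An index $i$ is called effective in a monomial $M$ in these variables if $M$ contains $Y_i$ or $Z_i$, and $M$ contains some $X_k$ with $k>i$ such that $M$ contains neither $Y_j$ nor $Z_j$ for each $i<j<k$. Let $\mathrm{eff}(M)$ be the number of effective indices in $M$. Let $\rho$ be the $K$-linear operator with values in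 $K$ that sends $f=\sum_M a_M M$ ($a_M\in K$) to $\rho(f)=\sum_M a_M s^{\mathrm{eff}(M)}$, defined for those $f\in K[[X,Y,Z]]$ for which this sum converges coefficientwise in $K$ (that is, each coefficient of the sum receives only finitely many nonzero contributions); in particular $\rho(M)=s^{\mathrm{eff}(M)}$ for each monomial $M$. For $m\ge 0$ put $$S_m(u)=\frac{\displaystyle\frac{\prod_{1\le j\le m}(1-uX_j)}{\prod_{0\le j\le m}(1-ruZ_j)}}{\displaystyle 1-\sum_{1\le l\le m}\frac{uX_l\prod_{1\le j\le l-1}(1-uX_j)}{\prod_{0\le j\le l-1}(1-uY_j)}}\in K[[X,Y,Z]].$$ **Theorem.** The series defining $F(t,s,r;u)$ converges coefficientwise in $K[[t]]$, $\rho(S_m(u))$ is defined for every $m\ge 0$, and $$F(t,s,r;u)=\sum_{m\ge 0}t^m\,\rho(S_m(u)).$$ -/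

import Mathlib

open scoped MvPowerSeries.WithPiTopology

noncomputable section

namespace CrossingDescents

/-! ### Permutation statistics

Permutations of `{1, …, n}` are modelled by `Equiv.Perm (Fin n)`; position and value `i : Fin n`
stand for `i + 1`. -/

/-- The set of descent positions `i`, i.e. `i + 1` is still a position and `π (i) > π (i + 1)`. -/
def descents {n : ℕ} (π : Equiv.Perm (Fin n)) : Finset (Fin n) :=
  {i : Fin n | ∃ h : (i : ℕ) + 1 < n, π i > π ⟨(i : ℕ) + 1, h⟩}

/-- The number of descents. -/
def des {n : ℕ} (π : Equiv.Perm (Fin n)) : ℕ := (descents π).card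

/-- The set of crossing descents: descents `i` with `π (i) ≥ i + 1 ≥ π (i + 1)`.
(This condition is unchanged when positions and values are both shifted by one.) -/
def crossingDescents {n : ℕ} (π : Equiv.Perm (Fin n)) : Finset (Fin n) :=
  {i ∈ descents π | ∃ h : (i : ℕ) + 1 < n,
    π i ≥ ⟨(i : ℕ) + 1, h⟩ ∧ (⟨(i : ℕ) + 1, h⟩ : Fin n) ≥ π ⟨(i : ℕ) + 1, h⟩}

/-- The number of crossing descents. -/
def xdes {n : ℕ} (π : Equiv.Perm (Fin n)) : ℕ := (crossingDescents π).card

/-- The number of fixed points. -/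
def fix {n : ℕ} (π : Equiv.Perm (Fin n)) : ℕ := Finset.card {i : Fin n | π i = i}

/-! ### Rings of power series

All rings of power series carry the topology of coefficientwise convergence
(the product topology, with `ℤ` discrete). -/

/-- The coefficient ring `K = ℤ[[s, r, u]]`. -/
abbrev K : Type := MvPowerSeries (Fin 3) ℤ

/-- The variable `s`. -/
def s : K := MvPowerSeries.X 0

/-- The variable `r`. -/
def r : K := MvPowerSeries.X 1

/-- The variable `u`. -/
def u : K := MvPowerSeries.X 2

/-- Names of the variables `X₀, X₁, …, Y₀, Y₁, …, Z₀, Z₁, …`. -/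
inductive Var : Type
  | x (i : ℕ)
  | y (i : ℕ)
  | z (i : ℕ)

/-- The ring `K[[X, Y, Z]]` of formal power series in the variables `X_i`, `Y_i`, `Z_i`. -/
abbrev KXYZ : Type := MvPowerSeries Var K

/-- The variable `X_i`. -/
def X (i : ℕ) : KXYZ := MvPowerSeries.X (Var.x i)

/-- The variable `Y_i`. -/
def Y (i : ℕ) : KXYZ := MvPowerSeries.X (Var.y i)

/-- The variable `Z_i`. -/
def Z (i : ℕ) : KXYZ := MvPowerSeries.X (Var.z i)

/-- Constants of `K`, as elements of `K[[X, Y, Z]]`. -/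
abbrev const (a : K) : KXYZ := MvPowerSeries.C a

/-! ### Effective indices and the operator `ρ` -/

/-- A monomial in the variables `X_i`, `Y_i`, `Z_i`, given by its exponents, contains a
given variable. -/
def Contains (M : Var →₀ ℕ) (v : Var) : Prop := M v ≠ 0

/-- The index `i` is effective in the monomial `M`: `M` contains `Y_i` or `Z_i`, and it contains
some `X_k` with `k > i` such that it contains neither `Y_j` nor `Z_j` for all `i < j < k`. -/
def IsEffective (M : Var →₀ ℕ) (i : ℕ) : Prop :=
  (Contains M (Var.y i) ∨ Contains M (Var.z i)) ∧
    ∃ k, i < k ∧ Contains M (Var.x k) ∧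
      ∀ j, i < j → j < k → ¬ Contains M (Var.y j) ∧ ¬ Contains M (Var.z j)

theorem finite_isEffective (M : Var →₀ ℕ) : {i | IsEffective M i}.Finite := by
  have hy : Function.Injective Var.y := fun a b h => by injection h
  have hz : Function.Injective Var.z := fun a b h => by injection h
  refine Set.Finite.subset
    ((M.hasFiniteSupport.preimage hy.injOn).union (M.hasFiniteSupport.preimage hz.injOn)) ?_
  intro i hi
  exact hi.1

/-- The number of effective indices in `M` (a finite number). -/
def eff (M : Var →₀ ℕ) : ℕ := {i | IsEffective M i}.ncard

/-- The `K`-submodule of those `f = ∑ a_M M` in `K[[X, Y, Z]]` for which the sum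
`∑ a_M s ^ eff M` over all monomials `M` converges in `K`. -/
def rhoDomain : Submodule K KXYZ where
  carrier := {f | Summable fun M : Var →₀ ℕ => MvPowerSeries.coeff M f * s ^ eff M}
  zero_mem' := by simp
  add_mem' {f g} hf hg := by
    simpa only [Set.mem_ofPred_eq, map_add, add_mul] using Summable.add hf hg
  smul_mem' c f hf := by
    simpa only [Set.mem_ofPred_eq, MvPowerSeries.coeff_smul, mul_assoc] using
      Summable.mul_left c hf

/-- The linear operator `ρ`, with `ρ (∑ a_M M) = ∑ a_M s ^ eff M`. -/
def rho : rhoDomain →ₗ[K] K where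
  toFun f := ∑' M : Var →₀ ℕ, MvPowerSeries.coeff M (f : KXYZ) * s ^ eff M
  map_add' f g := by
    simpa only [Submodule.coe_add, map_add, add_mul] using Summable.tsum_add f.2 g.2
  map_smul' c f := by
    simpa only [Submodule.coe_smul, MvPowerSeries.coeff_smul, mul_assoc, RingHom.id_apply,
      smul_eq_mul] using Summable.tsum_mul_left c f.2

theorem hasSum_monomial (M : Var →₀ ℕ) :
    HasSum (fun M' : Var →₀ ℕ =>
      MvPowerSeries.coeff M' (MvPowerSeries.monomial M (1 : K)) * s ^ eff M') (s ^ eff M) := by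
  classical
  convert hasSum_ite_eq M (s ^ eff M) using 2 with M'
  rw [MvPowerSeries.coeff_monomial]
  split_ifs with h
  · rw [one_mul, h]
  · rw [zero_mul]

theorem monomial_mem_rhoDomain (M : Var →₀ ℕ) :
    MvPowerSeries.monomial M (1 : K) ∈ rhoDomain := (hasSum_monomial M).summable

/-- `ρ M = s ^ eff M` for a monomial `M`. -/
theorem rho_monomial (M : Var →₀ ℕ) :
    rho ⟨MvPowerSeries.monomial M (1 : K), monomial_mem_rhoDomain M⟩ = s ^ eff M :=
  (hasSum_monomial M).tsum_eq

/-! ### The fraction `S_m(u)` -/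

/-- The reciprocal of a series in `K[[X, Y, Z]]` with constant coefficient `1`. -/
def recip (f : KXYZ) : KXYZ := MvPowerSeries.invOfUnit f 1

theorem mul_recip (f : KXYZ) (hf : MvPowerSeries.constantCoeff f = 1) : f * recip f = 1 :=
  MvPowerSeries.mul_invOfUnit f 1 (by simpa using hf)

/-- The product `∏_{0 ≤ j ≤ m} (1 - r u Z_j)`. -/
def denomZ (m : ℕ) : KXYZ := ∏ j ∈ Finset.Icc 0 m, (1 - const (r * u) * Z j)

/-- The product `∏_{0 ≤ j ≤ l - 1} (1 - u Y_j)`. -/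
def denomY (l : ℕ) : KXYZ := ∏ j ∈ Finset.range l, (1 - const u * Y j)

/-- The main denominator
`1 - ∑_{1 ≤ l ≤ m} u X_l ∏_{1 ≤ j ≤ l - 1} (1 - u X_j) / ∏_{0 ≤ j ≤ l - 1} (1 - u Y_j)`. -/
def mainDenom (m : ℕ) : KXYZ :=
  1 - ∑ l ∈ Finset.Icc 1 m,
    (const u * X l * ∏ j ∈ Finset.Ico 1 l, (1 - const u * X j)) * recip (denomY l)

/-- The fraction `S_m(u)`, namely
`(∏_{1 ≤ j ≤ m} (1 - u X_j) / ∏_{0 ≤ j ≤ m} (1 - r u Z_j)) / mainDenom m`. -/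
def S (m : ℕ) : KXYZ :=
  ((∏ j ∈ Finset.Icc 1 m, (1 - const u * X j)) * recip (denomZ m)) * recip (mainDenom m)

theorem constantCoeff_denomZ (m : ℕ) : MvPowerSeries.constantCoeff (denomZ m) = 1 := by
  simp [denomZ, Z]

theorem constantCoeff_denomY (l : ℕ) : MvPowerSeries.constantCoeff (denomY l) = 1 := by
  simp [denomY, Y]

theorem constantCoeff_mainDenom (m : ℕ) : MvPowerSeries.constantCoeff (mainDenom m) = 1 := by
  simp [mainDenom, X]

/-- `S m` is a genuine quotient: all the reciprocals in it are true inverses. -/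
theorem S_mul_denominators (m : ℕ) :
    S m * mainDenom m * denomZ m = ∏ j ∈ Finset.Icc 1 m, (1 - const u * X j) := by
  have h1 := mul_recip _ (constantCoeff_denomZ m)
  have h2 := mul_recip _ (constantCoeff_mainDenom m)
  calc S m * mainDenom m * denomZ m
      = (∏ j ∈ Finset.Icc 1 m, (1 - const u * X j)) * (denomZ m * recip (denomZ m)) *
          (mainDenom m * recip (mainDenom m)) := by unfold S; ring
    _ = _ := by rw [h1, h2, mul_one, mul_one]

/-! ### The generating function `F(t, s, r; u)` in `K[[t]] = ℤ[[s, r, u]][[t]]` -/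

/-- The variable `t`. -/
def t : PowerSeries K := PowerSeries.X

/-- The `n`-th term
`(∑_{π ∈ S_n} t ^ des π s ^ xdes π r ^ fix π) u ^ n / (1 - t) ^ (n + 1)`. -/
def termF (n : ℕ) : PowerSeries K :=
  (∑ π : Equiv.Perm (Fin n), t ^ des π * PowerSeries.C (s ^ xdes π) * PowerSeries.C (r ^ fix π)) *
    (PowerSeries.C (u ^ n) * PowerSeries.invOfUnit ((1 - t) ^ (n + 1)) 1)

theorem one_sub_t_pow_mul_inv (n : ℕ) :
    (1 - t) ^ (n + 1) * PowerSeries.invOfUnit ((1 - t) ^ (n + 1)) 1 = 1 :=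
  PowerSeries.mul_invOfUnit _ 1 (by simp [t])

/-- The generating function `F(t, s, r; u)`. -/
def F : PowerSeries K := ∑' n : ℕ, termF n

end CrossingDescents

end

/-! Both sides count words `w` over `{0, …, m}`. Sort `w` stably into decreasing order by a
permutation `π`. A given `π` arises from `(n + m - des π).choose n` words of length `n`
(`card_filter_sortPerm_eq`), which is the coefficient of `t ^ m` in `t ^ des π / (1 - t) ^ (n + 1)`.
So the coefficient of `t ^ m` in `F` is the sum of `u ^ n r ^ fix π s ^ xdes π` over all words
(`coeff_termF`).

On the other side, a letter `a` with `L` smaller letters on its left and `G` larger letters on its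
right weighs `u Y_a`, `r u Z_a` or `u X_a` according to `L < G`, `L = G` or `L > G`. Since `i - π i
= G - L` for the letter moved from place `π i` to place `i` (`smallerLeft_add`), these cases mean `π
i < i`, `π i = i` and `π i > i`. Hence the weight of a word is `u ^ n r ^ fix π` times a monomial,
whose effective indices are in bijection with the crossing descents of `π` (`eff_permMonomial`).

It remains to see that `S m` is the sum of the weights of all words. Let `v` mark length and let `W
m g` be the series of words with `g` top letters `m`, the top letters being unweighted and unmarked.
By induction `W m g = τ φ ^ g`. In a word with `g` letters `m + 1`, the weight of a letter `m`
depends only on its gap among the other letters: `y` in the first `g` gaps, `z` in the next, `x`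
afterwards. Changing the weight of one of the gaps `0, …, g` from `a` to `b` multiplies the series
by `(1 - v b) / (1 - v a)` (`one_sub_mul_gapSeries`), so all gaps may be given the weight `x`. Then
`m` and `m + 1` can be merged, and the negative binomial series yields the next pair `τ'`, `φ'`
(`exists_lowSeries_succ`). This recursion telescopes to the fraction (`lowSeries_closed_form`). -/

namespace CrossingDescents

/-! ### Weights of words, and insertion of a letter into a gap. -/

section Words

variable {A : Type*} [CommRing A]

/-- The product over the letters `a` of a word `w` of `f l a r`, where `l` lists the letters
to the left of `a` (in reverse order, followed by a given context) and `r` those to the right. -/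
def contextProd (f : List ℕ → ℕ → List ℕ → A) : List ℕ → List ℕ → A
  | _, [] => 1
  | l, a :: w => f l a w * contextProd f (a :: l) w

theorem contextProd_congr {f f' : List ℕ → ℕ → List ℕ → A} (l w : List ℕ)
    (h : ∀ p a q, w = p ++ a :: q → f (p.reverse ++ l) a q = f' (p.reverse ++ l) a q) :
    contextProd f l w = contextProd f' l w := by
  induction w generalizing l with
  | nil => rfl
  | cons a w ih =>
    simp only [contextProd]
    rw [ih]
    · rw [show f l a w = f' l a w from h [] a w rfl]
    · intro p b q hw
      simpa using h (a :: p) b q (by simp [hw])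

/-- The weight of a letter `a` with `L` smaller letters to its left and `G` larger letters to its
right. -/
def letterWeight (x y z : ℕ → A) (a L G : ℕ) : A :=
  if L < G then y a else if L = G then z a else x a

/-- The weight of a letter below `m` in context; the letter `m` and all letters above it
weigh `1`. -/
def lowWeight (x y z : ℕ → A) (m : ℕ) (l : List ℕ) (a : ℕ) (w : List ℕ) : A :=
  if a < m then letterWeight x y z a (l.countP (· < a)) (w.countP (a < ·)) else 1

/-- As `lowWeight`, but a letter `m` weighs `α i`, where `i` is the number of letters other than
`m` to its left. -/
def gapWeight (x y z : ℕ → A) (m : ℕ) (α : ℕ → A) (l : List ℕ) (a : ℕ) (w : List ℕ) : A :=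
  if a = m then α (l.countP (· ≠ m)) else lowWeight x y z m l a w

variable (x y z : ℕ → A) (m : ℕ)

theorem gapWeight_low (α : ℕ → A) (l : List ℕ) {a : ℕ} (h : a < m) (w : List ℕ) :
    gapWeight x y z m α l a w =
      letterWeight x y z a (l.countP (· < a)) (w.countP (a < ·)) := by
  simp [gapWeight, lowWeight, h, h.ne]

/-- The gap weights that agree with the letter weights. -/
def trueGap (g i : ℕ) : A := if i < g then y m else if i = g then z m else x m

theorem countP_ne_eq (l : List ℕ) :
    l.countP (· ≠ m) = l.countP (· < m) + l.countP (m < ·) := by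
  induction l with
  | nil => rfl
  | cons a l ih =>
    simp only [List.countP_cons, decide_eq_true_eq] at *
    split_ifs <;> omega

/-- A letter `m` with `L` smaller letters on its left and `G` letters `m + 1` on its right has `i =
L + (g - G)` letters other than `m` on its left. Comparing `L` with `G` is thus comparing `i` with
`g`. -/
theorem contextProd_lowWeight_succ {w : List ℕ} {g : ℕ} (hw : ∀ a ∈ w, a ≤ m + 1)
    (hg : w.count (m + 1) = g) :
    contextProd (lowWeight x y z (m + 1)) [] w =
      contextProd (gapWeight x y z m (trueGap x y z m g)) [] w := by
  apply contextProd_congr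
  intro p a q hpq
  have ha : a ≤ m + 1 := hw a (by simp [hpq])
  simp only [List.append_nil]
  rcases lt_trichotomy a m with h | h | h
  · rw [gapWeight_low _ _ _ _ _ _ h, lowWeight, if_pos (by omega)]
  · subst h
    have hcount : ∀ v : List ℕ, (∀ b ∈ v, b ≤ a + 1) → v.countP (a < ·) = v.count (a + 1) := by
      intro v hv
      refine List.countP_congr fun b hb => ?_
      have := hv b hb
      simp only [decide_eq_true_eq, beq_iff_eq]
      omega
    have h1 := hcount p (fun b hb => hw b (by simp [hpq, hb]))
    have h2 := hcount q (fun b hb => hw b (by simp [hpq, hb]))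
    have h3 : p.count (a + 1) + q.count (a + 1) = g := by
      rw [← hg, hpq]; simp
    have h4 := countP_ne_eq a p.reverse
    simp only [List.countP_reverse] at h4
    simp only [lowWeight, gapWeight, letterWeight, trueGap, lt_add_one, if_true,
      List.countP_reverse, h4, h1, h2]
    have e1 : (p.countP (· < a) < q.count (a + 1)) ↔
        (p.countP (· < a) + p.count (a + 1) < g) := by omega
    have e2 : (p.countP (· < a) = q.count (a + 1)) ↔
        (p.countP (· < a) + p.count (a + 1) = g) := by omega
    simp only [e1, e2]
  · have : a = m + 1 := by omega
    subst this
    simp [gapWeight, lowWeight]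

/-- Letters below `m` cannot tell `m` from the letters above it, so these may be merged. -/
theorem contextProd_gapWeight_const (c : A) (l w : List ℕ) :
    contextProd (gapWeight x y z m fun _ => c) l w =
      c ^ w.count m * contextProd (lowWeight x y z m) (l.map (min m)) (w.map (min m)) := by
  induction w generalizing l with
  | nil => simp [contextProd]
  | cons a w ih =>
    simp only [List.map_cons, contextProd, ih]
    rcases lt_trichotomy a m with h | h | h
    · have h1 : (l.map (min m)).countP (· < a) = l.countP (· < a) := by
        rw [List.countP_map]
        refine List.countP_congr fun b _ => ?_
        simp only [Function.comp, decide_eq_true_eq]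
        omega
      have h2 : (w.map (min m)).countP (a < ·) = w.countP (a < ·) := by
        rw [List.countP_map]
        refine List.countP_congr fun b _ => ?_
        simp only [Function.comp, decide_eq_true_eq]
        omega
      rw [gapWeight_low _ _ _ _ _ _ h, lowWeight, min_eq_right h.le, if_pos h, h1, h2,
        List.count_cons_of_ne h.ne]
      ring
    · subst h
      simp [gapWeight, lowWeight, pow_succ]
      ring
    · rw [List.count_cons_of_ne h.ne', min_eq_left h.le]
      simp [gapWeight, lowWeight, h.ne', h.le]

/-- An `m` on the left is not smaller than any letter below `m` and does not enter gap numbers, so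
what follows does not see it. -/
theorem contextProd_gapWeight_context (α : ℕ → A) (l₁ l₂ w : List ℕ) :
    contextProd (gapWeight x y z m α) (l₁ ++ m :: l₂) w =
      contextProd (gapWeight x y z m α) (l₁ ++ l₂) w := by
  induction w generalizing l₁ with
  | nil => rfl
  | cons a w ih =>
    simp only [contextProd]
    have := ih (a :: l₁)
    simp only [List.cons_append] at this
    rw [this]
    congr 1
    simp only [gapWeight, lowWeight, List.countP_append, List.countP_cons]
    split_ifs with h1 h2 h3 h4
    all_goals first | rfl | (simp at *; try omega)

/-- Only letters below `m` on the left of the new `m` could notice it. For these, `h` ensures that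
the letters above `m` in `q` alone outnumber the smaller letters on their left, so they weigh `y`
before and after. -/
theorem contextProd_gapWeight_insert (α : ℕ → A) (l p q : List ℕ)
    (h : l.countP (· < m) + (p ++ q).countP (· < m) ≤ q.countP (· ≠ m)) :
    contextProd (gapWeight x y z m α) l (p ++ m :: q) =
      α (l.countP (· ≠ m) + p.countP (· ≠ m)) *
        contextProd (gapWeight x y z m α) l (p ++ q) := by
  induction p generalizing l with
  | nil =>
    simp only [List.nil_append, contextProd, List.countP_nil, add_zero]
    have := contextProd_gapWeight_context x y z m α [] l q
    simp only [List.nil_append] at this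
    rw [this, gapWeight, if_pos rfl]
  | cons a p ih =>
    simp only [List.cons_append, contextProd]
    rw [ih (a :: l) (by simp only [List.countP_cons, List.cons_append] at *; omega)]
    have h1 : (a :: l).countP (· ≠ m) + p.countP (· ≠ m) =
        l.countP (· ≠ m) + (a :: p).countP (· ≠ m) := by
      simp only [List.countP_cons]; omega
    have h2 : gapWeight x y z m α l a (p ++ m :: q) = gapWeight x y z m α l a (p ++ q) := by
      rcases lt_or_ge a m with ha | ha
      · rw [gapWeight_low _ _ _ _ _ _ ha, gapWeight_low _ _ _ _ _ _ ha]
        have e1 : l.countP (· < a) ≤ l.countP (· < m) :=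
          List.countP_mono_left fun b _ hb => by
            simp only [decide_eq_true_eq] at *; omega
        have e2 : q.countP (m < ·) ≤ q.countP (a < ·) :=
          List.countP_mono_left fun b _ hb => by
            simp only [decide_eq_true_eq] at *; omega
        have e3 := countP_ne_eq m q
        simp only [List.cons_append, List.countP_cons, List.countP_append, ha, decide_true,
          if_true] at h
        have e4 : l.countP (· < a) < (p ++ m :: q).countP (a < ·) := by
          simp only [List.countP_append, List.countP_cons]; omega
        have e5 : l.countP (· < a) < (p ++ q).countP (a < ·) := by
          simp only [List.countP_append]; omega
        simp only [letterWeight, e4, e5, if_true]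
      · have : ¬ a < m := by omega
        simp [gapWeight, lowWeight, this]
    rw [h1, h2]
    ring

/-- Insert a letter `m` at the start of the gap number `c` between the letters other than `m`. -/
def insertGap (m : ℕ) : ℕ → List ℕ → List ℕ
  | 0, w => m :: w
  -- Value for a missing gap; it keeps the map injective on all words.
  | _ + 1, [] => []
  | c + 1, a :: w => a :: (if a = m then insertGap m (c + 1) w else insertGap m c w)

theorem insertGap_injective (c : ℕ) : Function.Injective (insertGap m c) := by
  intro w
  induction w generalizing c with
  | nil =>
    intro w' h
    cases c <;> cases w' <;> simp_all [insertGap]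
  | cons a w ih =>
    intro w' h
    cases c with
    | zero => simpa [insertGap] using h
    | succ c =>
      cases w' with
      | nil => simp [insertGap] at h
      | cons b w' =>
        simp only [insertGap, List.cons.injEq] at h
        obtain ⟨rfl, h⟩ := h
        split_ifs at h
        · rw [ih _ h]
        · rw [ih _ h]

theorem exists_insertGap_eq (c : ℕ) (w : List ℕ) (h : c ≤ w.countP (· ≠ m)) :
    ∃ p q, w = p ++ q ∧ insertGap m c w = p ++ m :: q ∧ p.countP (· ≠ m) = c := by
  induction w generalizing c with
  | nil =>
    obtain rfl : c = 0 := by simpa using h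
    exact ⟨[], [], by simp [insertGap]⟩
  | cons a w ih =>
    cases c with
    | zero => exact ⟨[], a :: w, by simp [insertGap]⟩
    | succ c =>
      by_cases ha : a = m
      · subst ha
        obtain ⟨p, q, h1, h2, h3⟩ := ih (c + 1) (by simpa using h)
        exact ⟨a :: p, q, by simp [h1], by simp [insertGap, h2], by simpa using h3⟩
      · obtain ⟨p, q, h1, h2, h3⟩ := ih c (by simpa [List.countP_cons, ha] using h)
        refine ⟨a :: p, q, by simp [h1], by simp [insertGap, h2, ha], ?_⟩
        simpa [List.countP_cons, ha] using h3

/-- The image of `insertGap m c` contains every word whose gap `c` is occupied: remove the first `m`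
of that gap. -/
theorem exists_insertGap_of_split (p q : List ℕ) :
    ∃ w, insertGap m (p.countP (· ≠ m)) w = p ++ m :: q ∧ (m :: w).Perm (p ++ m :: q) := by
  induction p with
  | nil => exact ⟨q, by simp [insertGap]⟩
  | cons a p ih =>
    obtain ⟨w, h1, h2⟩ := ih
    by_cases ha : a = m
    · subst ha
      simp only [List.countP_cons, ne_eq, not_true_eq_false, decide_false, add_zero,
        Bool.false_eq_true, if_false] at *
      by_cases hp : p.countP (fun b => !decide (b = a)) = 0
      · refine ⟨p ++ a :: q, ?_, by simp⟩
        simp [hp, insertGap]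
      · obtain ⟨c, hc⟩ := Nat.exists_eq_succ_of_ne_zero hp
        refine ⟨a :: w, ?_, by simpa using h2⟩
        simp only [decide_not, hc, insertGap, if_true] at *
        simp [h1]
    · refine ⟨a :: w, ?_, (List.Perm.swap a m w).trans (h2.cons a)⟩
      simp [ha, insertGap] at *
      exact h1

end Words

/-! ### Generating series of words by number of top letters. -/

section WordSums

variable {A : Type*} [CommRing A] (x y z : ℕ → A) (m : ℕ)

/-- The words over `{0, …, m}` with `n` letters below `m` and `g` letters `m`. -/
def topWords (m n g : ℕ) : Finset (List ℕ) :=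
  {w ∈ (Finset.univ : Finset (Fin (n + g) → Fin (m + 1))).image
    (fun w => List.ofFn fun i => (w i : ℕ)) | w.count m = g}

theorem mem_topWords {m n g : ℕ} {w : List ℕ} :
    w ∈ topWords m n g ↔ (∀ a ∈ w, a ≤ m) ∧ w.count m = g ∧ w.length = n + g := by
  simp only [topWords, Finset.mem_filter, Finset.mem_image, Finset.mem_univ, true_and]
  constructor
  · rintro ⟨⟨f, rfl⟩, h⟩
    refine ⟨?_, h, by simp⟩
    intro a ha
    obtain ⟨i, rfl⟩ := List.mem_ofFn.1 ha
    exact Nat.le_of_lt_succ (f i).2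
  · rintro ⟨h1, h2, h3⟩
    refine ⟨⟨fun i => ⟨w[i], Nat.lt_succ_of_le (h1 _ (List.getElem_mem _))⟩, ?_⟩, h2⟩
    apply List.ext_getElem <;> simp [h3]

theorem mem_topWords_of_perm {m n g : ℕ} {w w' : List ℕ} (h : w.Perm w') :
    w ∈ topWords m n g ↔ w' ∈ topWords m n g := by
  simp only [mem_topWords, h.mem_iff, h.count_eq, h.length_eq]

theorem cons_mem_topWords_succ {n g : ℕ} {w : List ℕ} :
    m :: w ∈ topWords (m + 1) (n + 1) g ↔ w ∈ topWords (m + 1) n g := by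
  simp only [mem_topWords, List.mem_cons, forall_eq_or_imp, List.length_cons]
  rw [List.count_cons_of_ne (by omega)]
  constructor
  · rintro ⟨⟨-, h1⟩, h2, h3⟩; exact ⟨h1, h2, by omega⟩
  · rintro ⟨h1, h2, h3⟩; exact ⟨⟨by omega, h1⟩, h2, by omega⟩

theorem le_countP_ne {n g : ℕ} {w : List ℕ} (hw : w ∈ topWords (m + 1) n g) :
    w.countP (· < m) + g ≤ w.countP (· ≠ m) := by
  obtain ⟨-, h2, -⟩ := mem_topWords.1 hw
  have : w.count (m + 1) ≤ w.countP (m < ·) := by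
    rw [List.count]
    exact List.countP_mono_left fun b _ hb => by simp at *; omega
  rw [countP_ne_eq]; omega

theorem insertGap_mem_topWords {n g c : ℕ} (hc : c ≤ g) {w : List ℕ}
    (hw : w ∈ topWords (m + 1) n g) : insertGap m c w ∈ topWords (m + 1) (n + 1) g := by
  obtain ⟨p, q, rfl, h2, -⟩ :=
    exists_insertGap_eq m c w (by have := le_countP_ne m hw; omega)
  rw [h2, mem_topWords_of_perm List.perm_middle, cons_mem_topWords_succ]
  exact hw

theorem contextProd_insertGap (α : ℕ → A) {n g c : ℕ} (hc : c ≤ g) {w : List ℕ}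
    (hw : w ∈ topWords (m + 1) n g) :
    contextProd (gapWeight x y z m α) [] (insertGap m c w) =
      α c * contextProd (gapWeight x y z m α) [] w := by
  have h := le_countP_ne m hw
  obtain ⟨p, q, rfl, h2, h3⟩ := exists_insertGap_eq m c w (by omega)
  rw [h2, contextProd_gapWeight_insert]
  · rw [h3, List.countP_nil, zero_add]
  · rw [List.countP_append (p := fun b => decide (b ≠ m)), h3] at h
    simp only [List.countP_nil]
    omega

/-- The sum of the gap weights, with a variable marking all letters except the largest. -/
def gapSeries (α : ℕ → A) (g : ℕ) : PowerSeries A :=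
  PowerSeries.mk fun n =>
    ∑ w ∈ topWords (m + 1) n g, contextProd (gapWeight x y z m α) [] w

/-- The sum of the weights of words over `{0, …, m}` with exactly `g` letters `m`, with a
variable marking the letters below `m`. -/
def lowSeries (g : ℕ) : PowerSeries A :=
  PowerSeries.mk fun n => ∑ w ∈ topWords m n g, contextProd (lowWeight x y z m) [] w

theorem lowSeries_succ (g : ℕ) :
    lowSeries x y z (m + 1) g = gapSeries x y z m (trueGap x y z m g) g := by
  ext n
  simp only [lowSeries, gapSeries, PowerSeries.coeff_mk]
  refine Finset.sum_congr rfl fun w hw => ?_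
  obtain ⟨h1, h2, -⟩ := mem_topWords.1 hw
  exact contextProd_lowWeight_succ x y z m h1 h2

theorem contextProd_gapWeight_eq_of_ne {α β : ℕ → A} {c : ℕ} (h : ∀ i, i ≠ c → α i = β i)
    {w : List ℕ} (hw : ∀ p q, w = p ++ m :: q → p.countP (· ≠ m) ≠ c) :
    contextProd (gapWeight x y z m α) [] w = contextProd (gapWeight x y z m β) [] w := by
  apply contextProd_congr
  intro p a q hpq
  simp only [List.append_nil, gapWeight]
  split_ifs with ha
  · subst ha
    exact h _ (by rw [List.countP_reverse]; exact hw p q hpq)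
  · rfl

/-- Inserting an `m` into gap `c` multiplies the weight by `α c`. The factor `1 - v α c` therefore
cancels all words except those with gap `c` empty, and these do not involve `α c`. -/
theorem one_sub_mul_gapSeries {α β : ℕ → A} {c g : ℕ} (hc : c ≤ g)
    (h : ∀ i, i ≠ c → α i = β i) :
    (1 - PowerSeries.X * PowerSeries.C (α c)) * gapSeries x y z m α g =
      (1 - PowerSeries.X * PowerSeries.C (β c)) * gapSeries x y z m β g := by
  have key : ∀ (γ : ℕ → A) (n : ℕ),
      ∑ w ∈ topWords (m + 1) (n + 1) g, contextProd (gapWeight x y z m γ) [] w -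
        γ c * ∑ w ∈ topWords (m + 1) n g, contextProd (gapWeight x y z m γ) [] w =
      ∑ w ∈ topWords (m + 1) (n + 1) g \ (topWords (m + 1) n g).image (insertGap m c),
        contextProd (gapWeight x y z m γ) [] w := by
    intro γ n
    have hsub : (topWords (m + 1) n g).image (insertGap m c) ⊆ topWords (m + 1) (n + 1) g := by
      intro w hw
      obtain ⟨v, hv, rfl⟩ := Finset.mem_image.1 hw
      exact insertGap_mem_topWords m hc hv
    rw [← Finset.sum_sdiff hsub, Finset.sum_image (insertGap_injective m c).injOn,
      Finset.mul_sum, Finset.sum_congr rfl fun w hw =>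
        contextProd_insertGap x y z m γ hc hw, add_sub_cancel_right]
  have expand : ∀ γ : ℕ → A, (1 - PowerSeries.X * PowerSeries.C (γ c)) * gapSeries x y z m γ g =
      gapSeries x y z m γ g - PowerSeries.X * (PowerSeries.C (γ c) * gapSeries x y z m γ g) :=
    fun γ => by ring
  rw [expand, expand]
  ext n
  cases n with
  | zero =>
    simp only [map_sub, PowerSeries.coeff_zero_X_mul, sub_zero, gapSeries, PowerSeries.coeff_mk]
    refine Finset.sum_congr rfl fun w hw => ?_
    refine contextProd_gapWeight_eq_of_ne x y z m h fun p q hpq => ?_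
    obtain ⟨-, h2, h3⟩ := mem_topWords.1 hw
    have h4 : m :: (p ++ q) ∈ topWords (m + 1) 0 g :=
      (mem_topWords_of_perm List.perm_middle).1 (hpq ▸ hw)
    obtain ⟨-, h5, h6⟩ := mem_topWords.1 h4
    rw [List.count_cons_of_ne (by omega)] at h5
    have := List.count_le_length (a := m + 1) (l := p ++ q)
    simp only [List.length_cons] at h6
    omega
  | succ n =>
    simp only [map_sub, PowerSeries.coeff_succ_X_mul, PowerSeries.coeff_C_mul, gapSeries,
      PowerSeries.coeff_mk]
    rw [key, key]
    refine Finset.sum_congr rfl fun w hw => ?_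
    refine contextProd_gapWeight_eq_of_ne x y z m h fun p q hpq hpc => ?_
    obtain ⟨hw1, hw2⟩ := Finset.mem_sdiff.1 hw
    obtain ⟨v, hv1, hv2⟩ := exists_insertGap_of_split m p q
    refine hw2 (Finset.mem_image.2 ⟨v, ?_, by rw [← hpc, hv1, hpq]⟩)
    rw [← cons_mem_topWords_succ, mem_topWords_of_perm hv2, ← hpq]
    exact hw1

theorem prod_mul_gapSeries (α : ℕ → A) (b : A) {c g : ℕ} (hc : c ≤ g + 1) :
    (∏ i ∈ Finset.range c, (1 - PowerSeries.X * PowerSeries.C (α i))) * gapSeries x y z m α g =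
      (1 - PowerSeries.X * PowerSeries.C b) ^ c *
        gapSeries x y z m (fun i => if i < c then b else α i) g := by
  induction c with
  | zero => simp
  | succ c ih =>
    have h := one_sub_mul_gapSeries x y z m (α := fun i => if i < c then b else α i)
      (β := fun i => if i < c + 1 then b else α i) (c := c) (g := g) (by omega) (by
        intro i hi
        have : i < c ↔ i < c + 1 := by omega
        simp only [this])
    simp only [lt_irrefl, if_false, lt_add_one, if_true] at h
    rw [Finset.prod_range_succ, mul_right_comm, ih (by omega), mul_assoc, mul_comm (gapSeries _ _ _ _ _ _),
      h, pow_succ]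
    ring

/-- Only the gaps `0, …, g` have to be changed: `g` of them weigh `y m`, gap `g` weighs `z m`, and
the later ones weigh `x m` already. -/
theorem lowSeries_succ_mul (g : ℕ) :
    (1 - PowerSeries.X * PowerSeries.C (y m)) ^ g * (1 - PowerSeries.X * PowerSeries.C (z m)) *
      lowSeries x y z (m + 1) g =
    (1 - PowerSeries.X * PowerSeries.C (x m)) ^ (g + 1) *
      gapSeries x y z m (fun _ => x m) g := by
  have h := prod_mul_gapSeries x y z m (trueGap x y z m g) (x m) (c := g + 1) (g := g) le_rfl
  rw [lowSeries_succ]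
  have e : (fun i => if i < g + 1 then x m else trueGap x y z m g i) = fun _ => x m := by
    funext i
    simp only [trueGap]
    split_ifs <;> first | rfl | omega
  rw [e] at h
  rw [← h, Finset.prod_range_succ]
  congr 2
  · rw [Finset.prod_congr rfl (g := fun _ => 1 - PowerSeries.X * PowerSeries.C (y m))]
    · simp
    · intro i hi
      simp [trueGap, Finset.mem_range.1 hi]
  · simp [trueGap]

/-- The words over `{0, …, m + 1}` with `g` letters `m + 1` that become `w` when every `m + 1` is
replaced by `m`. -/
def liftWords (m : ℕ) : List ℕ → ℕ → Finset (List ℕ)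
  | [], 0 => {[]}
  | [], _ + 1 => ∅
  | a :: w, 0 => (liftWords m w 0).image (List.cons a)
  | a :: w, g + 1 =>
    if a = m then
      (liftWords m w (g + 1)).image (List.cons m) ∪ (liftWords m w g).image (List.cons (m + 1))
    else (liftWords m w (g + 1)).image (List.cons a)

theorem card_liftWords (w : List ℕ) (g : ℕ) :
    (liftWords m w g).card = (w.count m).choose g := by
  induction w generalizing g with
  | nil => cases g <;> simp [liftWords]
  | cons a w ih =>
    cases g with
    | zero => simp [liftWords, Finset.card_image_of_injective _ (List.cons_injective), ih]
    | succ g =>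
      by_cases ha : a = m
      · subst ha
        rw [liftWords, if_pos rfl, Finset.card_union_of_disjoint]
        · rw [Finset.card_image_of_injective _ List.cons_injective,
            Finset.card_image_of_injective _ List.cons_injective, ih, ih, List.count_cons_self,
            Nat.choose_succ_succ, add_comm]
        · rw [Finset.disjoint_left]
          intro v hv hv'
          obtain ⟨_, _, rfl⟩ := Finset.mem_image.1 hv
          obtain ⟨_, _, h⟩ := Finset.mem_image.1 hv'
          simp at h
      · rw [liftWords, if_neg ha, Finset.card_image_of_injective _ List.cons_injective, ih,
          List.count_cons_of_ne ha]

theorem mem_liftWords {w : List ℕ} (hw : ∀ a ∈ w, a ≤ m) (g : ℕ) (v : List ℕ) :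
    v ∈ liftWords m w g ↔
      v.map (min m) = w ∧ (∀ a ∈ v, a ≤ m + 1) ∧ v.count (m + 1) = g := by
  induction w generalizing g v with
  | nil => cases g <;> cases v <;> simp [liftWords]
  | cons a w ih =>
    have ha : a ≤ m := hw a (by simp)
    have hw' : ∀ b ∈ w, b ≤ m := fun b hb => hw b (by simp [hb])
    cases v with
    | nil =>
      cases g
      · simp [liftWords]
      · by_cases h : a = m <;> simp [liftWords, h]
    | cons b v =>
      have hb : min m b = a ∧ b ≤ m + 1 ↔ b = a ∨ (a = m ∧ b = m + 1) := by omega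
      have hba : b ≠ m + 1 → (b :: v).count (m + 1) = v.count (m + 1) :=
        fun h => List.count_cons_of_ne h
      have hmb : ((m + 1) :: v).count (m + 1) = v.count (m + 1) + 1 := List.count_cons_self
      have reorg : ((b :: v).map (min m) = a :: w ∧ (∀ c ∈ b :: v, c ≤ m + 1) ∧
          (b :: v).count (m + 1) = g) ↔ (min m b = a ∧ b ≤ m + 1) ∧
            (v.map (min m) = w ∧ (∀ c ∈ v, c ≤ m + 1) ∧ (b :: v).count (m + 1) = g) := by
        simp only [List.map_cons, List.cons.injEq, List.mem_cons, forall_eq_or_imp]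
        tauto
      rw [reorg, hb]
      cases g with
      | zero =>
        simp only [liftWords, Finset.mem_image, ih hw', List.cons.injEq]
        constructor
        · rintro ⟨v', h, rfl, rfl⟩
          exact ⟨Or.inl rfl, by rw [hba (by omega)]; exact h⟩
        · rintro ⟨rfl | ⟨rfl, rfl⟩, h1, h2, h3⟩
          · exact ⟨v, ⟨h1, h2, by rw [hba (by omega)] at h3; exact h3⟩, rfl, rfl⟩
          · rw [hmb] at h3; omega
      | succ g =>
        by_cases h : a = m
        · subst h
          simp only [liftWords, if_true, Finset.mem_union, Finset.mem_image, ih hw',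
            List.cons.injEq, true_and]
          constructor
          · rintro (⟨v', h, rfl, rfl⟩ | ⟨v', h, rfl, rfl⟩)
            · exact ⟨Or.inl rfl, by rw [hba (by omega)]; exact h⟩
            · exact ⟨Or.inr rfl, by rw [hmb]; exact ⟨h.1, h.2.1, by rw [h.2.2]⟩⟩
          · rintro ⟨rfl | rfl, h1, h2, h3⟩
            · exact Or.inl ⟨v, ⟨h1, h2, by rw [hba (by omega)] at h3; exact h3⟩, rfl, rfl⟩
            · exact Or.inr ⟨v, ⟨h1, h2, by rw [hmb] at h3; omega⟩, rfl, rfl⟩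
        · simp only [liftWords, h, if_false, Finset.mem_image, ih hw', List.cons.injEq]
          constructor
          · rintro ⟨v', h, rfl, rfl⟩
            exact ⟨Or.inl rfl, by rw [hba (by omega)]; exact h⟩
          · rintro ⟨rfl | ⟨h', rfl⟩, h1, h2, h3⟩
            · exact ⟨v, ⟨h1, h2, by rw [hba (by omega)] at h3; exact h3⟩, rfl, rfl⟩
            · exact absurd h' (by tauto)

theorem count_map_min_of_mem_topWords {n g : ℕ} {v : List ℕ} (hv : v ∈ topWords (m + 1) n g) :
    (v.map (min m)).count m = v.count m + g := by
  obtain ⟨h1, h2, -⟩ := mem_topWords.1 hv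
  rw [← h2]
  clear h2 hv
  induction v with
  | nil => rfl
  | cons a v ih =>
    have := h1 a (by simp)
    have ih := ih fun b hb => h1 b (by simp [hb])
    simp only [List.map_cons, List.count_cons, ih, beq_iff_eq]
    split_ifs <;> omega

/-- Merging `m + 1` into `m` turns `p` letters `m` and `g` letters `m + 1` into `g + p` top letters;
the binomial coefficient counts the ways back. -/
theorem coeff_gapSeries_const (b : A) (n g : ℕ) :
    PowerSeries.coeff n (gapSeries x y z m (fun _ => b) g) =
      ∑ p ∈ Finset.range (n + 1), ((g + p).choose g : A) * b ^ p *
        PowerSeries.coeff (n - p) (lowSeries x y z m (g + p)) := by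
  simp only [gapSeries, lowSeries, PowerSeries.coeff_mk, contextProd_gapWeight_const,
    List.map_nil]
  have hle : ∀ v ∈ topWords (m + 1) n g, v.count m ∈ Finset.range (n + 1) := by
    intro v hv
    obtain ⟨-, h2, h3⟩ := mem_topWords.1 hv
    have : v.count m + v.count (m + 1) ≤ v.length := by
      clear hv h2 h3
      induction v with
      | nil => simp
      | cons a v ih => simp only [List.count_cons, beq_iff_eq, List.length_cons]; split_ifs <;> omega
    rw [Finset.mem_range]
    omega
  rw [← Finset.sum_fiberwise_of_maps_to hle]
  refine Finset.sum_congr rfl fun p hp => ?_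
  have hp : p ≤ n := by simpa [Nat.lt_succ_iff] using hp
  have hmap : ∀ v ∈ (topWords (m + 1) n g).filter (fun v => v.count m = p),
      v.map (min m) ∈ topWords m (n - p) (g + p) := by
    intro v hv
    obtain ⟨hv', hvp⟩ := Finset.mem_filter.1 hv
    have h := count_map_min_of_mem_topWords m hv'
    obtain ⟨h1, h2, h3⟩ := mem_topWords.1 hv'
    refine mem_topWords.2 ⟨?_, by omega, by rw [List.length_map]; omega⟩
    simp
  rw [← Finset.sum_fiberwise_of_maps_to hmap, Finset.mul_sum]
  refine Finset.sum_congr rfl fun w hw => ?_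
  obtain ⟨hw1, hw2, hw3⟩ := mem_topWords.1 hw
  have hfib : ((topWords (m + 1) n g).filter (fun v => v.count m = p)).filter
      (fun v => v.map (min m) = w) = liftWords m w g := by
    ext v
    rw [mem_liftWords m hw1]
    simp only [Finset.mem_filter]
    constructor
    · rintro ⟨⟨h1, -⟩, h2⟩
      obtain ⟨h3, h4, -⟩ := mem_topWords.1 h1
      exact ⟨h2, h3, h4⟩
    · rintro ⟨h1, h2, h3⟩
      have hv : v ∈ topWords (m + 1) n g := by
        refine mem_topWords.2 ⟨h2, h3, ?_⟩
        rw [← h1, List.length_map] at hw3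
        omega
      have := count_map_min_of_mem_topWords m hv
      rw [h1] at this
      exact ⟨⟨hv, by omega⟩, h1⟩
  rw [Finset.sum_congr rfl (g := fun _ => b ^ p * contextProd (lowWeight x y z m) [] w)]
  · rw [hfib, Finset.sum_const, card_liftWords, hw2, nsmul_eq_mul]
    ring
  · intro v hv
    obtain ⟨hv', hvw⟩ := Finset.mem_filter.1 hv
    rw [(Finset.mem_filter.1 hv').2, hvw]

end WordSums

/-! ### Solving the recursion on the largest letter. -/

section ClosedForm

variable {A : Type*} [CommRing A] (x y z : ℕ → A) (m : ℕ)

theorem one_sub_mul_sum_choose_mul_pow (q : A) (g n : ℕ) :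
    (1 - q) * ∑ p ∈ Finset.range (n + 1), ((g + 1 + p).choose (g + 1) : A) * q ^ p =
      ∑ p ∈ Finset.range (n + 1), ((g + p).choose g : A) * q ^ p -
        ((g + 1 + n).choose (g + 1) : A) * q ^ (n + 1) := by
  induction n with
  | zero => simp
  | succ n ih =>
    rw [Finset.sum_range_succ, mul_add, ih, Finset.sum_range_succ _ (n + 1),
      show g + 1 + (n + 1) = (g + 1 + n) + 1 by ring, Nat.choose_succ_succ (g + 1 + n) g,
      show g + 1 + n = g + (n + 1) by ring]
    push_cast
    ring

/-- Truncated negative binomial series, in any commutative ring; it avoids infinite sums of powers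
of a series. -/
theorem pow_dvd_mul_sum_choose_mul_pow_sub_one (q : A) (g n : ℕ) :
    q ^ (n + 1) ∣ (1 - q) ^ (g + 1) *
      (∑ p ∈ Finset.range (n + 1), ((g + p).choose g : A) * q ^ p) - 1 := by
  induction g with
  | zero =>
    refine ⟨-1, ?_⟩
    have := mul_neg_geom_sum q (n + 1)
    simp [this]
  | succ g ih =>
    obtain ⟨d, hd⟩ := ih
    refine ⟨d - (1 - q) ^ (g + 1) * ((g + 1 + n).choose (g + 1) : A), ?_⟩
    rw [pow_succ (1 - q) (g + 1), mul_assoc, one_sub_mul_sum_choose_mul_pow]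
    linear_combination hd

theorem eq_of_forall_X_pow_dvd_sub {f g : PowerSeries A}
    (h : ∀ n, (PowerSeries.X : PowerSeries A) ^ (n + 1) ∣ f - g) : f = g := by
  ext n
  have := PowerSeries.X_pow_dvd_iff.1 (h n) n (Nat.lt_succ_self n)
  rwa [map_sub, sub_eq_zero] at this

variable {x y z m} in
theorem pow_mul_gapSeries_const {τ φ : PowerSeries A}
    (h : ∀ g, lowSeries x y z m g = τ * φ ^ g) (b : A) (g : ℕ) :
    (1 - PowerSeries.X * PowerSeries.C b * φ) ^ (g + 1) * gapSeries x y z m (fun _ => b) g =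
      τ * φ ^ g := by
  refine eq_of_forall_X_pow_dvd_sub fun n => ?_
  set q : PowerSeries A := PowerSeries.X * PowerSeries.C b * φ with hq
  set P : PowerSeries A := ∑ p ∈ Finset.range (n + 1), ((g + p).choose g : PowerSeries A) * q ^ p
  -- Work modulo `X ^ (n + 1)`, where the truncation `P` is exact because `X` divides `q`.
  have h1 : (PowerSeries.X : PowerSeries A) ^ (n + 1) ∣
      gapSeries x y z m (fun _ => b) g - τ * φ ^ g * P := by
    rw [PowerSeries.X_pow_dvd_iff]
    intro k hk
    have e : τ * φ ^ g * P = ∑ p ∈ Finset.range (n + 1),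
        PowerSeries.X ^ p * (PowerSeries.C (((g + p).choose g : A) * b ^ p) *
          (τ * φ ^ (g + p))) := by
      rw [Finset.mul_sum]
      refine Finset.sum_congr rfl fun p _ => ?_
      rw [hq]
      simp only [map_mul, map_natCast, map_pow]
      ring
    rw [map_sub, coeff_gapSeries_const, e, map_sum, sub_eq_zero]
    simp only [PowerSeries.coeff_X_pow_mul', PowerSeries.coeff_C_mul, ← h]
    rw [← Finset.sum_filter]
    congr 1
    ext p
    simp only [Finset.mem_range, Finset.mem_filter]
    omega
  have h2 : (PowerSeries.X : PowerSeries A) ^ (n + 1) ∣ (1 - q) ^ (g + 1) * P - 1 := by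
    refine dvd_trans ?_ (pow_dvd_mul_sum_choose_mul_pow_sub_one q g n)
    exact pow_dvd_pow_of_dvd ⟨PowerSeries.C b * φ, by rw [hq, mul_assoc]⟩ _
  obtain ⟨d1, hd1⟩ := h1
  obtain ⟨d2, hd2⟩ := h2
  exact ⟨(1 - q) ^ (g + 1) * d1 + τ * φ ^ g * d2, by
    linear_combination (1 - q) ^ (g + 1) * hd1 + τ * φ ^ g * hd2⟩

theorem isUnit_one_sub_X_mul (f : PowerSeries A) : IsUnit (1 - PowerSeries.X * f) := by
  rw [PowerSeries.isUnit_iff_constantCoeff]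
  simp

variable {x y z m} in
theorem exists_lowSeries_succ {τ φ : PowerSeries A}
    (h : ∀ g, lowSeries x y z m g = τ * φ ^ g) :
    ∃ τ' φ' : PowerSeries A, (∀ g, lowSeries x y z (m + 1) g = τ' * φ' ^ g) ∧
      τ' * (1 - PowerSeries.X * PowerSeries.C (z m)) *
        (1 - PowerSeries.X * PowerSeries.C (x m) * φ) =
          τ * (1 - PowerSeries.X * PowerSeries.C (x m)) ∧
      φ' * (1 - PowerSeries.X * PowerSeries.C (y m)) *
        (1 - PowerSeries.X * PowerSeries.C (x m) * φ) =
          φ * (1 - PowerSeries.X * PowerSeries.C (x m)) := by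
  obtain ⟨uy, hy⟩ := isUnit_one_sub_X_mul (PowerSeries.C (y m))
  obtain ⟨uz, hz⟩ := isUnit_one_sub_X_mul (PowerSeries.C (z m))
  obtain ⟨uq, hq⟩ := isUnit_one_sub_X_mul (PowerSeries.C (x m) * φ)
  rw [← mul_assoc] at hq
  set X' := 1 - PowerSeries.X * PowerSeries.C (x m) with hX'
  have hτ : τ * ↑uz⁻¹ * ↑uq⁻¹ * X' * uz * uq = τ * X' := by
    have e1 := uz.inv_mul
    have e2 := uq.inv_mul
    linear_combination τ * X' * e1 + τ * X' * (↑uz⁻¹ * ↑uz) * e2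
  have hφ : φ * ↑uy⁻¹ * ↑uq⁻¹ * X' * uy * uq = φ * X' := by
    have e1 := uy.inv_mul
    have e2 := uq.inv_mul
    linear_combination φ * X' * e1 + φ * X' * (↑uy⁻¹ * ↑uy) * e2
  refine ⟨τ * ↑uz⁻¹ * ↑uq⁻¹ * X', φ * ↑uy⁻¹ * ↑uq⁻¹ * X', fun g => ?_, ?_, ?_⟩
  · have h1 := lowSeries_succ_mul x y z m g
    have h2 := pow_mul_gapSeries_const h (x m) g
    rw [← hy, ← hz, ← hX'] at h1
    rw [← hq] at h2
    clear_value X'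
    have hu : IsUnit ((uy : PowerSeries A) ^ g * uz * uq ^ (g + 1)) :=
      ((uy.isUnit.pow g).mul uz.isUnit).mul (uq.isUnit.pow _)
    apply hu.mul_left_cancel
    calc (uy : PowerSeries A) ^ g * uz * uq ^ (g + 1) * lowSeries x y z (m + 1) g
        = uq ^ (g + 1) * (uy ^ g * uz * lowSeries x y z (m + 1) g) := by ring
      _ = X' ^ (g + 1) * (uq ^ (g + 1) * gapSeries x y z m (fun _ => x m) g) := by
        rw [h1]; ring
      _ = (τ * X') * (φ * X') ^ g := by rw [h2]; ring
      _ = _ := by rw [← hτ, ← hφ]; ring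
  · rw [← hz, ← hq, hτ]
  · rw [← hy, ← hq, hφ]

/-- The induction starts with `τ = φ = 1`: the only word is `0 ^ g`, and top letters are unweighted.
-/
theorem lowSeries_zero (g : ℕ) : lowSeries x y z 0 g = 1 := by
  ext n
  simp only [lowSeries, PowerSeries.coeff_mk, PowerSeries.coeff_one]
  have hrep : ∀ w ∈ topWords 0 n g, w = List.replicate g 0 ∧ n = 0 := by
    intro w hw
    obtain ⟨h1, h2, h3⟩ := mem_topWords.1 hw
    have h : w = List.replicate w.length 0 :=
      List.eq_replicate_length.2 fun b hb => Nat.le_zero.1 (h1 b hb)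
    rw [h, List.count_replicate_self] at h2
    exact ⟨by rw [h, h2], by omega⟩
  split_ifs with hn
  · subst hn
    have : topWords 0 0 g = {List.replicate g 0} := by
      ext w
      rw [Finset.mem_singleton]
      refine ⟨fun h => (hrep w h).1, ?_⟩
      rintro rfl
      refine mem_topWords.2 ⟨fun a ha => (List.eq_of_mem_replicate ha).le, by simp, by simp⟩
    rw [this, Finset.sum_singleton]
    have : ∀ l w, contextProd (lowWeight x y z 0) l w = 1 := by
      intro l w
      induction w generalizing l with
      | nil => rfl
      | cons a w ih => simp [contextProd, ih, lowWeight]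
    exact this _ _
  · exact Finset.sum_eq_zero fun w hw => absurd (hrep w hw).2 hn

/-- The product of `1 - v a_j` over a finite set of indices, `v` being the series variable. -/
noncomputable def oneSubProd (a : ℕ → A) (s : Finset ℕ) : PowerSeries A :=
  ∏ j ∈ s, (1 - PowerSeries.X * PowerSeries.C (a j))

theorem isUnit_oneSubProd (a : ℕ → A) (s : Finset ℕ) : IsUnit (oneSubProd a s) :=
  IsUnit.prod_iff.2 fun _ _ => isUnit_one_sub_X_mul _

/-- As `φ = Q m / D m`, the recursion for `D` reads `D (m + 1) = D m * (1 - v x_{m+1} φ)`. This is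
the denominator produced by `exists_lowSeries_succ`, so the product telescopes. -/
theorem lowSeries_closed_form {D Q : ℕ → PowerSeries A} (hD0 : D 0 = 1)
    (hD : ∀ m, D (m + 1) = D m - PowerSeries.X * PowerSeries.C (x (m + 1)) * Q m)
    (hQ : ∀ m, Q m * oneSubProd y (Finset.range (m + 1)) = oneSubProd x (Finset.Icc 1 m)) :
    ∃ τ φ : PowerSeries A, (∀ g, lowSeries x y z (m + 1) g = τ * φ ^ g) ∧
      τ * D m * oneSubProd z (Finset.range (m + 1)) = oneSubProd x (Finset.Icc 1 m) ∧
      φ * D m = Q m := by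
  induction m with
  | zero =>
    obtain ⟨τ, φ, h, h1, h2⟩ := exists_lowSeries_succ (x := x) (y := y) (z := z) (m := 0)
      (τ := 1) (φ := 1) (by simp [lowSeries_zero])
    -- With `φ = 1` the factor `1 - v x_0` cancels, which is why `X_0` does not occur in the
    -- fraction.
    have hu := isUnit_one_sub_X_mul (PowerSeries.C (x 0))
    simp only [one_mul, mul_one] at h1 h2
    have h1 := hu.mul_right_cancel (h1.trans (one_mul _).symm)
    have h2 := hu.mul_right_cancel (h2.trans (one_mul _).symm)
    refine ⟨τ, φ, h, ?_, ?_⟩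
    · simp [oneSubProd, hD0, h1]
    · have := hQ 0
      apply (isUnit_oneSubProd y (Finset.range 1)).mul_right_cancel
      rw [hD0, mul_one, this]
      simp [oneSubProd, h2]
  | succ m ih =>
    obtain ⟨τ, φ, h, h1, h2⟩ := ih
    obtain ⟨τ', φ', h', h1', h2'⟩ := exists_lowSeries_succ h
    have hDm : D (m + 1) = D m * (1 - PowerSeries.X * PowerSeries.C (x (m + 1)) * φ) := by
      rw [hD, ← h2]; ring
    have hx : oneSubProd x (Finset.Icc 1 (m + 1)) = oneSubProd x (Finset.Icc 1 m) *
        (1 - PowerSeries.X * PowerSeries.C (x (m + 1))) := by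
      rw [oneSubProd, Finset.prod_Icc_succ_top (by omega)]; rfl
    have hr : ∀ a : ℕ → A, oneSubProd a (Finset.range (m + 1 + 1)) =
        oneSubProd a (Finset.range (m + 1)) *
          (1 - PowerSeries.X * PowerSeries.C (a (m + 1))) := fun a => Finset.prod_range_succ _ _
    refine ⟨τ', φ', h', ?_, ?_⟩
    · rw [hDm, hx, hr, ← h1]
      linear_combination (D m * oneSubProd z (Finset.range (m + 1))) * h1'
    · apply (isUnit_oneSubProd y (Finset.range (m + 2))).mul_right_cancel
      rw [hQ, hDm, hx, hr, ← hQ m, ← h2]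
      linear_combination (D m * oneSubProd y (Finset.range (m + 1))) * h2'

end ClosedForm

/-! ### From lists to words as functions. -/

section WordFunctions

variable {A : Type*} [CommRing A] (x y z : ℕ → A) (m : ℕ)

/-- The number of smaller letters to the left of position `i` in a word. -/
def smallerLeft {n : ℕ} (w : Fin n → ℕ) (i : Fin n) : ℕ :=
  ∑ j : Fin n, if j < i ∧ w j < w i then 1 else 0

/-- The number of larger letters to the right of position `i` in a word. -/
def largerRight {n : ℕ} (w : Fin n → ℕ) (i : Fin n) : ℕ :=
  ∑ j : Fin n, if i < j ∧ w i < w j then 1 else 0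

theorem countP_ofFn {n : ℕ} (w : Fin n → ℕ) (p : ℕ → Bool) :
    (List.ofFn w).countP p = ∑ j : Fin n, if p (w j) then 1 else 0 := by
  induction n with
  | zero => simp
  | succ n ih => rw [List.ofFn_succ, List.countP_cons, ih, Fin.sum_univ_succ, add_comm]

theorem contextProd_ofFn (l : List ℕ) {n : ℕ} (w : Fin n → ℕ) (hw : ∀ i, w i < m) :
    contextProd (lowWeight x y z m) l (List.ofFn w) =
      ∏ i, letterWeight x y z (w i) (l.countP (· < w i) + smallerLeft w i) (largerRight w i) := by
  induction n generalizing l with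
  | zero => simp [contextProd]
  | succ n ih =>
    rw [List.ofFn_succ, contextProd, ih _ _ (fun i => hw _), Fin.prod_univ_succ, lowWeight,
      if_pos (hw 0), countP_ofFn]
    congr 1
    · congr 1
      · simp [smallerLeft]
      · rw [largerRight, Fin.sum_univ_succ]
        simp
    · refine Finset.prod_congr rfl fun i _ => ?_
      congr 1
      · simp only [smallerLeft, Fin.sum_univ_succ (n := n), List.countP_cons, decide_eq_true_eq,
          Fin.succ_pos, true_and, Fin.succ_lt_succ_iff]
        ring
      · rw [largerRight, largerRight, Fin.sum_univ_succ]
        simp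

theorem coeff_lowSeries_zero (n : ℕ) :
    PowerSeries.coeff n (lowSeries x y z (m + 1) 0) =
      ∑ w : Fin n → Fin (m + 1), ∏ i, letterWeight x y z (w i)
        (smallerLeft (fun j => (w j : ℕ)) i) (largerRight (fun j => (w j : ℕ)) i) := by
  simp only [lowSeries, PowerSeries.coeff_mk]
  symm
  refine Finset.sum_bij (fun w _ => List.ofFn fun i => (w i : ℕ)) ?_ ?_ ?_ ?_
  · intro w _
    refine mem_topWords.2 ⟨?_, ?_, by simp⟩
    · intro a ha
      obtain ⟨i, rfl⟩ := List.mem_ofFn.1 ha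
      exact (w i).2.le
    · rw [List.count_eq_zero]
      intro ha
      obtain ⟨i, hi⟩ := List.mem_ofFn.1 ha
      exact (w i).2.ne hi
  · intro w _ w' _ h
    funext i
    exact Fin.ext (congrFun (List.ofFn_injective h) i)
  · intro v hv
    obtain ⟨h1, h2, h3⟩ := mem_topWords.1 hv
    have h4 : ∀ a ∈ v, a < m + 1 := fun a ha =>
      lt_of_le_of_ne (h1 a ha) fun e => List.count_eq_zero.1 h2 (e ▸ ha)
    rw [add_zero] at h3
    refine ⟨fun i => ⟨v[i], h4 _ (List.getElem_mem _)⟩, Finset.mem_univ _, ?_⟩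
    apply List.ext_getElem <;> simp [h3]
  · intro w _
    rw [contextProd_ofFn _ _ _ _ _ _ fun i => (w i).2]
    simp

end WordFunctions

/-! ### Homogenization, which makes degree visible as a power of a new variable. -/

section Homogenize

variable {σ R : Type*} [CommRing R]

/-- The homogeneous component of degree `n` of a multivariate power series. -/
noncomputable def homogeneousPart (n : ℕ) (f : MvPowerSeries σ R) : MvPowerSeries σ R :=
  fun M => if M.degree = n then MvPowerSeries.coeff M f else 0

theorem coeff_homogeneousPart (n : ℕ) (f : MvPowerSeries σ R) (M : σ →₀ ℕ) :
    MvPowerSeries.coeff M (homogeneousPart n f) =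
      if M.degree = n then MvPowerSeries.coeff M f else 0 := rfl

/-- The homogenization of a multivariate power series: every variable is multiplied by a new
variable. -/
noncomputable def homogenize : MvPowerSeries σ R →+* PowerSeries (MvPowerSeries σ R) where
  toFun f := PowerSeries.mk fun n => homogeneousPart n f
  map_one' := by
    classical
    ext n M
    rw [PowerSeries.coeff_mk, PowerSeries.coeff_one, coeff_homogeneousPart,
      MvPowerSeries.coeff_one]
    by_cases hM : M = 0
    · subst hM
      by_cases hn : n = 0
      · simp [hn]
      · simp [hn, Ne.symm hn]
    · by_cases hn : n = 0 <;> simp [hn, hM, MvPowerSeries.coeff_one]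
  map_zero' := by
    ext n M
    rw [PowerSeries.coeff_mk, coeff_homogeneousPart]
    simp
  map_add' f g := by
    ext n M
    simp only [map_add, PowerSeries.coeff_mk, coeff_homogeneousPart]
    split_ifs <;> simp
  map_mul' f g := by
    classical
    ext n M
    rw [PowerSeries.coeff_mk, PowerSeries.coeff_mul, map_sum]
    simp only [PowerSeries.coeff_mk, MvPowerSeries.coeff_mul, coeff_homogeneousPart]
    rw [Finset.sum_comm]
    have h : ∀ p ∈ Finset.HasAntidiagonal.antidiagonal M, ∑ q ∈ Finset.HasAntidiagonal.antidiagonal n,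
        (if p.1.degree = q.1 then MvPowerSeries.coeff p.1 f else 0) *
          (if p.2.degree = q.2 then MvPowerSeries.coeff p.2 g else 0) =
        if M.degree = n then MvPowerSeries.coeff p.1 f * MvPowerSeries.coeff p.2 g else 0 := by
      intro p hp
      have hM : M.degree = p.1.degree + p.2.degree := by
        rw [← Finset.HasAntidiagonal.mem_antidiagonal.1 hp, map_add]
      split_ifs with hn
      · rw [Finset.sum_eq_single (p.1.degree, p.2.degree)]
        · simp
        · intro q _ hq
          by_cases h1 : p.1.degree = q.1
          · have h2 : p.2.degree ≠ q.2 := fun h2 => hq (by rw [h1, h2])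
            simp [h2]
          · simp [h1]
        · intro hq
          exact absurd (Finset.HasAntidiagonal.mem_antidiagonal.2 (by rw [← hM, hn])) hq
      · refine Finset.sum_eq_zero fun q hq => ?_
        have hq := Finset.HasAntidiagonal.mem_antidiagonal.1 hq
        by_cases h1 : p.1.degree = q.1
        · have h2 : p.2.degree ≠ q.2 := by omega
          simp [h2]
        · simp [h1]
    rw [Finset.sum_congr rfl h]
    split_ifs <;> simp

theorem coeff_coeff_homogenize (f : MvPowerSeries σ R) (n : ℕ) (M : σ →₀ ℕ) :
    MvPowerSeries.coeff M (PowerSeries.coeff n (homogenize f)) =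
      if M.degree = n then MvPowerSeries.coeff M f else 0 := by
  rw [homogenize, RingHom.coe_mk, MonoidHom.coe_mk, OneHom.coe_mk, PowerSeries.coeff_mk,
    coeff_homogeneousPart]

theorem homogenize_C (a : R) :
    homogenize (MvPowerSeries.C a : MvPowerSeries σ R) = PowerSeries.C (MvPowerSeries.C a) := by
  classical
  ext n M
  rw [coeff_coeff_homogenize, PowerSeries.coeff_C]
  by_cases hM : M = 0
  · subst hM
    by_cases hn : n = 0
    · simp [hn]
    · simp [hn, Ne.symm hn]
  · by_cases hn : n = 0 <;> simp [hn, hM, MvPowerSeries.coeff_C]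

theorem homogenize_X (v : σ) :
    homogenize (MvPowerSeries.X v : MvPowerSeries σ R) =
      PowerSeries.X * PowerSeries.C (MvPowerSeries.X v) := by
  classical
  ext n M
  rw [coeff_coeff_homogenize, MvPowerSeries.coeff_X]
  cases n with
  | zero =>
    rw [PowerSeries.coeff_zero_X_mul]
    split_ifs with h1 h2
    · subst h2; simp at h1
    all_goals simp
  | succ n =>
    rw [PowerSeries.coeff_succ_X_mul, PowerSeries.coeff_C]
    by_cases hM : M = Finsupp.single v 1
    · subst hM
      by_cases hn : n = 0
      · simp [hn, MvPowerSeries.coeff_X]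
      · simp [hn]
    · by_cases hn : n = 0 <;> simp [hn, hM, MvPowerSeries.coeff_X]

end Homogenize

/-! ### The fraction as a sum over words. -/

section Fraction

/-- The weight `u X_j`. -/
noncomputable def weightX (j : ℕ) : KXYZ := const u * X j

/-- The weight `u Y_j`. -/
noncomputable def weightY (j : ℕ) : KXYZ := const u * Y j

/-- The weight `r u Z_j`. -/
noncomputable def weightZ (j : ℕ) : KXYZ := const (r * u) * Z j

theorem homogenize_weight (a : K) (v : Var) :
    homogenize (const a * MvPowerSeries.X v : KXYZ) =
      PowerSeries.X * PowerSeries.C (const a * MvPowerSeries.X v) := by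
  rw [map_mul, homogenize_X, const, homogenize_C, map_mul]
  ring

theorem homogenize_prod_one_sub (a : ℕ → KXYZ) (s : Finset ℕ)
    (ha : ∀ j, homogenize (a j) = PowerSeries.X * PowerSeries.C (a j)) :
    homogenize (∏ j ∈ s, (1 - a j)) = oneSubProd a s := by
  simp [oneSubProd, map_prod, ha]

theorem mainDenom_succ (m : ℕ) :
    mainDenom (m + 1) = mainDenom m - const u * X (m + 1) *
      ((∏ j ∈ Finset.Icc 1 m, (1 - const u * X j)) * recip (denomY (m + 1))) := by
  rw [mainDenom, mainDenom, Finset.sum_Icc_succ_top (by omega)]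
  rw [show Finset.Ico 1 (m + 1) = Finset.Icc 1 m by ext; simp]
  ring

/-- Homogenizing a letter weight multiplies it by the length variable, so the homogenized fraction
is the closed form at `g = 0`: no letter `m + 1`, every letter weighted. -/
theorem homogenize_S (m : ℕ) :
    homogenize (S m) = lowSeries weightX weightY weightZ (m + 1) 0 := by
  have hx : ∀ j, homogenize (weightX j) = PowerSeries.X * PowerSeries.C (weightX j) :=
    fun j => homogenize_weight _ _
  have hy : ∀ j, homogenize (weightY j) = PowerSeries.X * PowerSeries.C (weightY j) :=
    fun j => homogenize_weight _ _
  have hz : ∀ j, homogenize (weightZ j) = PowerSeries.X * PowerSeries.C (weightZ j) :=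
    fun j => homogenize_weight _ _
  have px := fun s => homogenize_prod_one_sub _ s hx
  have py := fun s => homogenize_prod_one_sub _ s hy
  have pz := fun s => homogenize_prod_one_sub _ s hz
  obtain ⟨τ, φ, h, h1, -⟩ := lowSeries_closed_form weightX weightY weightZ m
    (D := fun m => homogenize (mainDenom m))
    (Q := fun m => homogenize
      ((∏ j ∈ Finset.Icc 1 m, (1 - const u * X j)) * recip (denomY (m + 1))))
    (by simp [mainDenom])
    (fun m => by
      simp only [mainDenom_succ m, map_sub, map_mul _ (const u * X (m + 1))]
      rw [← hx]; rfl)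
    (fun m => by
      rw [← py, ← px, ← map_mul, mul_assoc, mul_comm (recip _)]
      congr 1
      change _ * (denomY (m + 1) * _) = _
      rw [mul_recip _ (constantCoeff_denomY _), mul_one]
      rfl)
  have hz' : oneSubProd weightZ (Finset.range (m + 1)) = homogenize (denomZ m) := by
    rw [← pz, denomZ, show Finset.Icc 0 m = Finset.range (m + 1) by ext; simp]
    rfl
  have hu : IsUnit (mainDenom m * denomZ m) :=
    (IsUnit.of_mul_eq_one _ (mul_recip _ (constantCoeff_mainDenom m))).mul
      (IsUnit.of_mul_eq_one _ (mul_recip _ (constantCoeff_denomZ m)))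
  apply (hu.map homogenize).mul_right_cancel
  rw [← map_mul, ← mul_assoc, S_mul_denominators, h 0, pow_zero, mul_one, map_mul, ← mul_assoc,
    ← hz', h1, ← px]
  rfl

theorem coeff_S (m : ℕ) (M : Var →₀ ℕ) :
    MvPowerSeries.coeff M (S m) = ∑ w : Fin M.degree → Fin (m + 1),
      MvPowerSeries.coeff M (∏ i, letterWeight weightX weightY weightZ (w i)
        (smallerLeft (fun j => (w j : ℕ)) i) (largerRight (fun j => (w j : ℕ)) i)) := by
  have h := coeff_coeff_homogenize (S m) M.degree M
  rw [if_pos rfl, homogenize_S, coeff_lowSeries_zero, map_sum] at h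
  exact h.symm

end Fraction

/-! ### Stable sorting, and effective indices against crossing descents. -/

section Permutations

variable {n : ℕ}

/-- The stable sorting permutation that puts the letters of a word in decreasing order. -/
def sortPerm (w : Fin n → ℕ) : Equiv.Perm (Fin n) :=
  Tuple.sort fun i => OrderDual.toDual (w i)

/-- `c` is weakly decreasing, and `π` increases along every block of equal values of `c`. -/
def IsCompatible (π : Equiv.Perm (Fin n)) (c : Fin n → ℕ) : Prop :=
  ∀ i j, i < j → c j ≤ c i ∧ (c i = c j → π i < π j)

theorem eq_sortPerm_iff {w : Fin n → ℕ} {π : Equiv.Perm (Fin n)} :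
    π = sortPerm w ↔ IsCompatible π fun i => w (π i) := by
  rw [sortPerm, Tuple.eq_sort_iff]
  constructor
  · rintro ⟨h1, h2⟩ i j hij
    exact ⟨h1 hij.le, fun h => h2 i j hij (congrArg _ h)⟩
  · intro h
    refine ⟨fun i j hij => ?_, fun i j hij he => (h i j hij).2 he⟩
    rcases hij.eq_or_lt with rfl | hij
    · exact le_rfl
    · exact (h i j hij).1

theorem isCompatible_of_succ {π : Equiv.Perm (Fin n)} {c : Fin n → ℕ}
    (h : ∀ (i : Fin n) (hi : (i : ℕ) + 1 < n), c ⟨i + 1, hi⟩ ≤ c i ∧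
      (π ⟨i + 1, hi⟩ < π i → c ⟨i + 1, hi⟩ < c i)) : IsCompatible π c := by
  have key : ∀ (d : ℕ) (i j : Fin n), (j : ℕ) = i + d + 1 →
      c j ≤ c i ∧ (c i = c j → π i < π j) := by
    intro d
    induction d with
    | zero =>
      intro i j hij
      have hi : (i : ℕ) + 1 < n := by have := j.2; omega
      obtain rfl : j = ⟨i + 1, hi⟩ := Fin.ext (by simpa using hij)
      refine ⟨(h i hi).1, fun he => ?_⟩
      have h2 := (h i hi).2
      rcases lt_trichotomy (π i) (π ⟨i + 1, hi⟩) with h3 | h3 | h3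
      · exact h3
      · have := congrArg Fin.val (π.injective h3)
        simp at this
      · have := h2 h3
        omega
    | succ d ih =>
      intro i j hij
      have hi : (i : ℕ) + 1 < n := by have := j.2; omega
      have h1 := ih ⟨i + 1, hi⟩ j (by simp; omega)
      have h2 := h i hi
      refine ⟨h1.1.trans h2.1, fun he => ?_⟩
      have h3 : c i = c ⟨i + 1, hi⟩ := le_antisymm (he ▸ h1.1) h2.1
      have h4 := h1.2 (h3 ▸ he)
      by_contra h5
      have := h2.2 (lt_of_lt_of_le h4 (not_lt.1 h5))
      omega
  exact fun i j hij => key (j - i - 1) i j (by have := Fin.lt_def.1 hij; omega)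

theorem sum_lt_eq (i : Fin n) : (i : ℕ) = ∑ j : Fin n, if j < i then 1 else 0 := by
  rw [Finset.sum_boole, ← Fin.card_Iio i]
  simp only [Nat.cast_id]
  congr 1
  ext j
  simp

/-- Before the letter come, in sorted order, all larger letters and the equal ones on its left; in
`w`, the smaller, equal and larger ones on its left. The common terms cancel. -/
theorem smallerLeft_add {w : Fin n → ℕ} {π : Equiv.Perm (Fin n)} (h : π = sortPerm w)
    (i : Fin n) : smallerLeft w (π i) + i = largerRight w (π i) + π i := by
  have h := eq_sortPerm_iff.1 h
  rw [smallerLeft, largerRight, ← Equiv.sum_comp π, sum_lt_eq i, ← Finset.sum_add_distrib,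
    sum_lt_eq (π i), ← Equiv.sum_comp π (fun v => if π i < v ∧ w (π i) < w v then 1 else 0),
    ← Equiv.sum_comp π (fun v => if v < π i then 1 else 0), ← Finset.sum_add_distrib]
  refine Finset.sum_congr rfl fun j _ => ?_
  rcases lt_trichotomy j i with hj | rfl | hj
  · have h1 := h j i hj
    have hne : (π j : ℕ) ≠ π i := fun e => hj.ne (π.injective (Fin.ext e))
    simp only [Fin.lt_def] at *
    split_ifs <;> omega
  · simp
  · have h1 := h i j hj
    have hne : (π i : ℕ) ≠ π j := fun e => hj.ne (π.injective (Fin.ext e))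
    simp only [Fin.lt_def] at *
    split_ifs <;> omega

/-- The variable attached to a letter `a` moved from place `i` to place `v`. -/
def typeVar (i v a : ℕ) : Var := if v < i then Var.y a else if v = i then Var.z a else Var.x a

/-- The monomial attached to a permutation and a sequence of letters. -/
noncomputable def permMonomial (π : Equiv.Perm (Fin n)) (c : Fin n → ℕ) : Var →₀ ℕ :=
  ∑ i : Fin n, Finsupp.single (typeVar i (π i) (c i)) 1

theorem degree_permMonomial (π : Equiv.Perm (Fin n)) (c : Fin n → ℕ) :
    (permMonomial π c).degree = n := by
  simp [permMonomial, map_sum]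

theorem contains_permMonomial (π : Equiv.Perm (Fin n)) (c : Fin n → ℕ) (v : Var) :
    Contains (permMonomial π c) v ↔ ∃ i : Fin n, typeVar i (π i) (c i) = v := by
  classical
  rw [Contains, permMonomial, Finsupp.finsetSum_apply, Ne, Finset.sum_eq_zero_iff]
  simp [Finsupp.single_apply]

theorem contains_x_iff (π : Equiv.Perm (Fin n)) (c : Fin n → ℕ) (a : ℕ) :
    Contains (permMonomial π c) (Var.x a) ↔ ∃ i : Fin n, i < π i ∧ c i = a := by
  rw [contains_permMonomial]
  refine exists_congr fun i => ?_
  rw [typeVar, Fin.lt_def]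
  split_ifs with h1 h2
  · simp; omega
  · simp; omega
  · simp; omega

theorem contains_y_or_z_iff (π : Equiv.Perm (Fin n)) (c : Fin n → ℕ) (a : ℕ) :
    (Contains (permMonomial π c) (Var.y a) ∨ Contains (permMonomial π c) (Var.z a)) ↔
      ∃ i : Fin n, π i ≤ i ∧ c i = a := by
  rw [contains_permMonomial, contains_permMonomial, ← exists_or]
  refine exists_congr fun i => ?_
  rw [typeVar, Fin.le_def]
  split_ifs with h1 h2
  · simp; omega
  · simp; omega
  · simp; omega

theorem IsCompatible.antitone {π : Equiv.Perm (Fin n)} {c : Fin n → ℕ} (h : IsCompatible π c) :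
    Antitone c := fun i j hij => by
  rcases hij.eq_or_lt with rfl | hij
  · exact le_rfl
  · exact (h i j hij).1

/-- On a block of equal letters `π i - i` is weakly increasing, so places with `π i ≤ i` precede
those with `π i > i`. -/
theorem IsCompatible.add_le {π : Equiv.Perm (Fin n)} {c : Fin n → ℕ} (h : IsCompatible π c)
    {i j : Fin n} (hij : i ≤ j) (hc : c i = c j) : (π i : ℕ) + (j - i) ≤ π j := by
  obtain ⟨d, hd⟩ := Nat.exists_eq_add_of_le (Fin.le_def.1 hij)
  induction d generalizing j with
  | zero =>
    obtain rfl : j = i := Fin.ext (by simpa using hd)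
    simp
  | succ d ih =>
    have hk : (i : ℕ) + d < n := by have := j.2; omega
    have hik : i ≤ ⟨i + d, hk⟩ := Fin.le_def.2 (by simp)
    have hkj : (⟨i + d, hk⟩ : Fin n) < j := Fin.lt_def.2 (by simp; omega)
    have h1 := h.antitone hik
    have h2 := h.antitone hkj.le
    have h3 := ih hik (by omega) (by simp)
    have h4 := Fin.lt_def.1 ((h _ _ hkj).2 (by omega))
    simp only at h3
    omega

theorem mem_crossingDescents {π : Equiv.Perm (Fin n)} {i : Fin n} :
    i ∈ crossingDescents π ↔ ∃ h : (i : ℕ) + 1 < n, (i : ℕ) < π i ∧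
      (π ⟨i + 1, h⟩ : ℕ) ≤ i + 1 := by
  simp only [crossingDescents, descents, Finset.mem_filter, Finset.mem_univ, true_and, gt_iff_lt,
    ge_iff_le, Fin.lt_def, Fin.le_def]
  constructor
  · rintro ⟨-, h, h1, h2⟩
    exact ⟨h, by omega, h2⟩
  · rintro ⟨h, h1, h2⟩
    refine ⟨⟨h, ?_⟩, h, by omega, h2⟩
    have : (π i : ℕ) ≠ π ⟨i + 1, h⟩ := fun e => by
      have := congrArg Fin.val (π.injective (Fin.ext e))
      simp at this
    omega

/-- A crossing descent `i` corresponds to the letter `c (i + 1)`. The letter drops there, since `π`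
cannot descend inside a block, so `i + 1` starts its block. Conversely, an effective letter gives
the place just before its block. -/
theorem eff_permMonomial {π : Equiv.Perm (Fin n)} {c : Fin n → ℕ} (hc : IsCompatible π c) :
    eff (permMonomial π c) = xdes π := by
  have hlt : ∀ (i : Fin n) (h : (i : ℕ) + 1 < n), (i : ℕ) < π i →
      (π ⟨i + 1, h⟩ : ℕ) ≤ i + 1 → c ⟨i + 1, h⟩ < c i := by
    intro i h h1 h2
    have h3 := hc i ⟨i + 1, h⟩ (Fin.lt_def.2 (by simp))
    refine lt_of_le_of_ne h3.1 fun e => ?_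
    have := Fin.lt_def.1 (h3.2 e.symm)
    omega
  -- The value `0` is taken only at the last place, which is never a crossing descent.
  let f : Fin n → ℕ := fun i => if h : (i : ℕ) + 1 < n then c ⟨i + 1, h⟩ else 0
  have hf : ∀ (i : Fin n) (h : (i : ℕ) + 1 < n), f i = c ⟨i + 1, h⟩ := fun i h => dif_pos h
  have hinj : Set.InjOn f (crossingDescents π : Set (Fin n)) := by
    have key : ∀ i j : Fin n, i ∈ crossingDescents π → j ∈ crossingDescents π → i < j →
        f j < f i := by
      intro i j hi hj hij
      obtain ⟨h1, -, -⟩ := mem_crossingDescents.1 hi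
      obtain ⟨h2, h3, h4⟩ := mem_crossingDescents.1 hj
      rw [hf i h1, hf j h2]
      exact lt_of_lt_of_le (hlt j h2 h3 h4)
        (hc.antitone (Fin.le_def.2 (by have := Fin.lt_def.1 hij; simp; omega)))
    intro i hi j hj hij
    rcases lt_trichotomy i j with h | h | h
    · exact absurd hij (key i j hi hj h).ne'
    · exact h
    · exact absurd hij (key j i hj hi h).ne
  rw [eff, xdes, ← Set.ncard_coe_finset, ← hinj.ncard_image]
  congr 1
  ext a
  simp only [Set.mem_ofPred_eq, Set.mem_image, Finset.mem_coe, IsEffective, contains_y_or_z_iff,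
    contains_x_iff, ← not_or]
  constructor
  · rintro ⟨⟨q, hq, rfl⟩, k, hk, ⟨p, hp, rfl⟩, hbetween⟩
    -- the first position of the letter `c q`
    have hex : ∃ b : ℕ, ∃ hb : b < n, c ⟨b, hb⟩ = c q := ⟨q, q.2, rfl⟩
    classical
    obtain ⟨hb, hbq⟩ := Nat.find_spec hex
    have hmin := fun {b'} => Nat.find_min (m := b') hex
    generalize Nat.find hex = b at hb hbq hmin
    have hbq' : b ≤ q := by
      by_contra hlt
      exact hmin (not_le.1 hlt) ⟨q.2, rfl⟩
    have hpb : (p : ℕ) < b := by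
      by_contra hle
      have := hc.antitone (show (⟨b, hb⟩ : Fin n) ≤ p from Fin.le_def.2 (not_lt.1 hle))
      omega
    obtain ⟨e, rfl⟩ : ∃ e, b = e + 1 := ⟨b - 1, by omega⟩
    have he : e < n := by omega
    have hce : c q < c ⟨e, he⟩ := by
      refine lt_of_le_of_ne ?_ fun h => hmin (Nat.lt_succ_self e) ⟨he, h.symm⟩
      exact hc.antitone (Fin.le_def.2 (by simp; omega))
    refine ⟨⟨e, he⟩, mem_crossingDescents.2 ⟨hb, ?_, ?_⟩, by rw [hf _ hb]; exact hbq⟩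
    -- If `π e ≤ e`, then either `e` follows `p` in the same block, where `π p > p` forces `π e >
    -- e`, or `c e` is a `Y` or `Z` index strictly between.
    · by_contra hle
      have hcp : c ⟨e, he⟩ ≤ c p := hc.antitone (Fin.le_def.2 (by simp; omega))
      rcases hcp.eq_or_lt with heq | hlt'
      · have := hc.add_le (i := p) (j := ⟨e, he⟩) (Fin.le_def.2 (by simp; omega)) heq.symm
        have := Fin.lt_def.1 hp
        simp only at *
        omega
      · exact hbetween _ hce hlt' ⟨⟨e, he⟩, Fin.le_def.2 (not_lt.1 hle), rfl⟩
    -- The inequality `π q ≤ q` passes back to the start of the block.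
    · have := hc.add_le (i := ⟨e + 1, hb⟩) (j := q) (Fin.le_def.2 hbq') hbq
      have := Fin.le_def.1 hq
      simp only at *
      omega
  · rintro ⟨i, hi, rfl⟩
    obtain ⟨h1, h2, h3⟩ := mem_crossingDescents.1 hi
    rw [hf i h1]
    refine ⟨⟨⟨i + 1, h1⟩, Fin.le_def.2 h3, rfl⟩, c i, hlt i h1 h2 h3,
      ⟨i, Fin.lt_def.2 h2, rfl⟩, ?_⟩
    rintro a h4 h5 ⟨j, -, rfl⟩
    have h6 : i < j := by
      by_contra h
      have := hc.antitone (not_lt.1 h)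
      omega
    have := hc.antitone (show (⟨i + 1, h1⟩ : Fin n) ≤ j from
      Fin.le_def.2 (by have := Fin.lt_def.1 h6; simp; omega))
    omega

end Permutations

/-! ### Counting the words with a given sorting permutation. -/

section Counting

variable {n : ℕ}

/-- The number of descents at or after a given position. -/
def tailDes (π : Equiv.Perm (Fin n)) (i : Fin n) : ℕ := {j ∈ descents π | i ≤ j}.card

theorem mem_descents {π : Equiv.Perm (Fin n)} {i : Fin n} :
    i ∈ descents π ↔ ∃ h : (i : ℕ) + 1 < n, π ⟨i + 1, h⟩ < π i := by
  simp [descents]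

theorem tailDes_eq (π : Equiv.Perm (Fin n)) (i : Fin n) (h : (i : ℕ) + 1 < n) :
    tailDes π i = tailDes π ⟨i + 1, h⟩ + if π ⟨i + 1, h⟩ < π i then 1 else 0 := by
  have hsucc : ∀ j : Fin n, i ≤ j ↔ j = i ∨ (⟨i + 1, h⟩ : Fin n) ≤ j := by
    intro j
    simp only [Fin.le_def, Fin.ext_iff]
    omega
  have hnot : i ∉ (descents π).filter fun j => (⟨i + 1, h⟩ : Fin n) ≤ j := by
    simp [Fin.le_def]
  split_ifs with hd
  · rw [tailDes, tailDes, ← Finset.card_insert_of_notMem hnot]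
    congr 1
    ext j
    simp only [Finset.mem_filter, Finset.mem_insert, hsucc j]
    constructor
    · tauto
    · rintro (rfl | hj)
      · exact ⟨mem_descents.2 ⟨h, hd⟩, Or.inl rfl⟩
      · tauto
  · rw [tailDes, tailDes, add_zero]
    congr 1
    ext j
    simp only [Finset.mem_filter, hsucc j]
    constructor
    · rintro ⟨hj, rfl | hj'⟩
      · exact absurd (mem_descents.1 hj).2 hd
      · exact ⟨hj, hj'⟩
    · tauto

theorem tailDes_add_lt (π : Equiv.Perm (Fin n)) (i : Fin n) : tailDes π i + i < n := by
  have hn : n - 1 < n := by have := i.2; omega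
  have hsub : (descents π).filter (fun j => i ≤ j) ⊆ Finset.Ico i ⟨n - 1, hn⟩ := by
    intro j hj
    obtain ⟨h1, h2⟩ := Finset.mem_filter.1 hj
    obtain ⟨h3, -⟩ := mem_descents.1 h1
    exact Finset.mem_Ico.2 ⟨h2, Fin.lt_def.2 (by simp; omega)⟩
  have h := Finset.card_le_card hsub
  rw [Fin.card_Ico] at h
  have := i.2
  simp only [tailDes] at *
  omega

theorem des_le_add_tailDes (π : Equiv.Perm (Fin n)) (i : Fin n) : des π ≤ i + tailDes π i := by
  have h : descents π ⊆ Finset.Iio i ∪ (descents π).filter (fun j => i ≤ j) := by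
    intro j hj
    rcases lt_or_ge j i with h | h
    · simp [h]
    · simp [h, hj]
  have h := (Finset.card_le_card h).trans (Finset.card_union_le _ _)
  rwa [Fin.card_Iio] at h

theorem tailDes_le_des (π : Equiv.Perm (Fin n)) (i : Fin n) : tailDes π i ≤ des π :=
  Finset.card_le_card (Finset.filter_subset _ _)

theorem strictMono_of_lt_next {f : Fin n → ℕ}
    (h : ∀ (i : Fin n) (hi : (i : ℕ) + 1 < n), f i < f ⟨i + 1, hi⟩) : StrictMono f := by
  cases n with
  | zero => exact fun i => i.elim0
  | succ n =>
    rw [Fin.strictMono_iff_lt_succ]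
    exact fun i => h i.castSucc (by simp)

theorem add_sub_le_of_strictMono {f : Fin n → ℕ} (h : StrictMono f) {i j : Fin n} (hij : i ≤ j) :
    f i + (j - i) ≤ f j := by
  obtain ⟨d, hd⟩ := Nat.exists_eq_add_of_le (Fin.le_def.1 hij)
  induction d generalizing j with
  | zero =>
    obtain rfl : j = i := Fin.ext (by simpa using hd)
    simp
  | succ d ih =>
    have hk : (i : ℕ) + d < n := by have := j.2; omega
    have h1 := ih (j := ⟨i + d, hk⟩) (Fin.le_def.2 (by simp)) rfl
    have h2 := h (show (⟨i + d, hk⟩ : Fin n) < j from Fin.lt_def.2 (by simp; omega))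
    simp only at h1
    omega

/-- Such words are the weakly decreasing sequences `w ∘ π` bounded by `m` that drop strictly at the
descents of `π`. Subtracting the number of later descents removes the strictness condition;
reversing and adding the index gives the strictly increasing maps into `n + m - des π` values. -/
theorem card_filter_sortPerm_eq (π : Equiv.Perm (Fin n)) (m : ℕ) :
    (Finset.univ.filter fun w : Fin n → Fin (m + 1) => sortPerm (fun i => (w i : ℕ)) = π).card =
      (n + m - des π).choose n := by
  have hcard : (n + m - des π).choose n =
      (Finset.univ : Finset (Fin n ↪o Fin (n + m - des π))).card := by
    rw [Finset.card_univ, ← Nat.card_eq_fintype_card,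
      Nat.card_congr Set.powersetCard.ofFinEmbEquiv, Set.powersetCard.card]
    simp
  have hrev : ∀ i : Fin n, ((Fin.rev i : Fin n) : ℕ) = n - 1 - i := fun i => by
    rw [Fin.val_rev]; omega
  let e : (Fin n → Fin (m + 1)) → Fin n → ℕ :=
    fun w k => (w (π k.rev) : ℕ) + k - tailDes π k.rev
  have he_lt : ∀ w k, e w k < n + m - des π := by
    intro w k
    have h1 := des_le_add_tailDes π k.rev
    have h2 := tailDes_add_lt π k.rev
    have h3 := tailDes_le_des π k.rev
    have h4 := (w (π k.rev)).2
    have h5 := k.2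
    rw [hrev] at h1 h2
    simp only [e]
    omega
  have he_mono : ∀ w : Fin n → Fin (m + 1), sortPerm (fun i => (w i : ℕ)) = π →
      StrictMono (e w) := by
    intro w hw
    have hc := eq_sortPerm_iff.1 hw.symm
    refine strictMono_of_lt_next fun k hk => ?_
    obtain ⟨i, hi⟩ : ∃ i, i = Fin.rev (⟨k + 1, hk⟩ : Fin n) := ⟨_, rfl⟩
    have hiv : (i : ℕ) = n - 1 - (k + 1) := by rw [hi, hrev]
    have hi1 : (i : ℕ) + 1 < n := by omega
    have hi2 : Fin.rev k = ⟨i + 1, hi1⟩ := Fin.ext (by rw [hrev]; simp; omega)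
    have h1 := tailDes_eq π i hi1
    have h2 := hc i ⟨i + 1, hi1⟩ (Fin.lt_def.2 (by simp))
    have h3 := tailDes_add_lt π i
    have h4 := tailDes_add_lt π ⟨i + 1, hi1⟩
    simp only [e, ← hi, hi2]
    simp only at h2 h4
    split_ifs at h1 with hd
    · have : (w (π i) : ℕ) ≠ w (π ⟨i + 1, hi1⟩) := fun h => absurd (h2.2 h) (not_lt.2 hd.le)
      omega
    · omega
  rw [hcard]
  refine Finset.card_bij
    (fun w hw => OrderEmbedding.ofStrictMono (fun k => ⟨e w k, he_lt w k⟩)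
      fun a b hab => Fin.lt_def.2 (he_mono w (Finset.mem_filter.1 hw).2 hab)) ?_ ?_ ?_
  · intro w hw
    exact Finset.mem_univ _
  · intro w hw w' hw' h
    funext v
    have h1 : e w (Fin.rev (π.symm v)) = e w' (Fin.rev (π.symm v)) :=
      congrArg Fin.val (DFunLike.congr_fun h (Fin.rev (π.symm v)))
    have h2 := tailDes_add_lt π (π.symm v)
    simp only [e, Fin.rev_rev, Equiv.apply_symm_apply, hrev] at h1
    exact Fin.ext (by omega)
  · intro g _
    have hg : StrictMono fun k => (g k : ℕ) := fun a b hab => Fin.lt_def.1 (g.strictMono hab)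
    -- A strictly increasing `g` satisfies `k ≤ g k`, so the subtraction in `c` below is not
    -- truncated.
    have hlow : ∀ i : Fin n, n - 1 - i ≤ (g i.rev : ℕ) := by
      intro i
      have hn : 0 < n := by have := i.2; omega
      have := add_sub_le_of_strictMono hg (i := ⟨0, hn⟩) (j := i.rev) (Fin.le_def.2 (by simp))
      rw [hrev] at this
      simp only at this
      omega
    have hup : ∀ i : Fin n, (g i.rev : ℕ) + i < n + m - des π := by
      intro i
      have hn : n - 1 < n := by have := i.2; omega
      have h1 := add_sub_le_of_strictMono hg (i := i.rev) (j := ⟨n - 1, hn⟩)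
        (Fin.le_def.2 (by rw [hrev]; simp))
      rw [hrev] at h1
      have h2 := (g ⟨n - 1, hn⟩).2
      have := i.2
      simp only at h1
      omega
    let c : Fin n → ℕ := fun i => (g i.rev : ℕ) + tailDes π i - (n - 1 - i)
    have hc_lt : ∀ i, c i < m + 1 := by
      intro i
      have h1 := hlow i
      have h2 := hup i
      have h3 := tailDes_le_des π i
      have h4 := i.2
      simp only [c]
      omega
    have hc : IsCompatible π c := by
      refine isCompatible_of_succ fun i hi => ?_
      have h1 := tailDes_eq π i hi
      have h2 : (g (Fin.rev ⟨i + 1, hi⟩) : ℕ) < g i.rev :=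
        hg (Fin.lt_def.2 (by rw [hrev, hrev]; simp; omega))
      have h3 := hlow i
      have h4 := hlow ⟨i + 1, hi⟩
      simp only at h4
      simp only [c]
      split_ifs at h1 with hd
      · exact ⟨by omega, fun _ => by omega⟩
      · exact ⟨by omega, fun h => absurd h hd⟩
    refine ⟨fun v => ⟨c (π.symm v), hc_lt _⟩, ?_, ?_⟩
    · rw [Finset.mem_filter]
      refine ⟨Finset.mem_univ _, ?_⟩
      rw [eq_comm, eq_sortPerm_iff]
      simpa using hc
    · ext k
      have h1 := hlow k.rev
      have h2 := tailDes_add_lt π k.rev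
      rw [hrev, Fin.rev_rev] at h1
      rw [hrev] at h2
      have h3 := k.2
      simp only [OrderEmbedding.coe_ofStrictMono, e, Equiv.symm_apply_apply, c, Fin.rev_rev, hrev]
      omega

theorem sum_sortPerm {B : Type*} [CommRing B] (m : ℕ) (φ : Equiv.Perm (Fin n) → B) :
    ∑ w : Fin n → Fin (m + 1), φ (sortPerm fun i => (w i : ℕ)) =
      ∑ π, ((n + m - des π).choose n : B) * φ π := by
  rw [← Finset.sum_fiberwise_of_maps_to
    (g := fun w : Fin n → Fin (m + 1) => sortPerm fun i => (w i : ℕ)) (t := Finset.univ)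
    (fun _ _ => Finset.mem_univ _)]
  refine Finset.sum_congr rfl fun π _ => ?_
  rw [Finset.sum_congr rfl (g := fun _ => φ π) fun w hw => by rw [(Finset.mem_filter.1 hw).2],
    Finset.sum_const, card_filter_sortPerm_eq, nsmul_eq_mul]

theorem des_le (π : Equiv.Perm (Fin n)) : des π ≤ n :=
  (Finset.card_le_univ _).trans_eq (Fintype.card_fin n)

theorem invOfUnit_one_sub_pow (n : ℕ) :
    PowerSeries.invOfUnit ((1 - t) ^ (n + 1)) 1 =
      PowerSeries.mk fun k => ((n + k).choose n : K) := by
  have h1 := one_sub_t_pow_mul_inv n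
  have h2 := PowerSeries.mk_add_choose_mul_one_sub_pow_eq_one K n
  calc PowerSeries.invOfUnit ((1 - t) ^ (n + 1)) 1
      = (PowerSeries.mk (fun k => ((n + k).choose n : K)) * (1 - PowerSeries.X) ^ (n + 1)) *
        PowerSeries.invOfUnit ((1 - t) ^ (n + 1)) 1 := by rw [h2, one_mul]
    _ = _ := by rw [mul_assoc]; exact (congrArg _ h1).trans (mul_one _)

theorem coeff_termF (m n : ℕ) :
    PowerSeries.coeff m (termF n) = ∑ w : Fin n → Fin (m + 1),
      u ^ n * r ^ fix (sortPerm fun i => (w i : ℕ)) * s ^ xdes (sortPerm fun i => (w i : ℕ)) := by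
  rw [sum_sortPerm m fun π : Equiv.Perm (Fin n) => u ^ n * r ^ fix π * s ^ xdes π, termF,
    Finset.sum_mul, map_sum, invOfUnit_one_sub_pow]
  refine Finset.sum_congr rfl fun π _ => ?_
  rw [show t ^ des π * PowerSeries.C (s ^ xdes π) * PowerSeries.C (r ^ fix π) *
      (PowerSeries.C (u ^ n) * PowerSeries.mk fun k => ((n + k).choose n : K)) =
      PowerSeries.X ^ des π * (PowerSeries.C (u ^ n * r ^ fix π * s ^ xdes π) *
        PowerSeries.mk fun k => ((n + k).choose n : K)) by
    simp only [map_mul, t]; ring]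
  rw [PowerSeries.coeff_X_pow_mul', PowerSeries.coeff_C_mul, PowerSeries.coeff_mk]
  have := des_le π
  split_ifs with h
  · rw [mul_comm, Nat.add_sub_assoc h]
  -- For `des π > m` no word exists; as `des π ≤ n`, the upper index is a true difference, smaller
  -- than `n`.
  · rw [Nat.choose_eq_zero_of_lt (by omega)]
    simp

end Counting

/-! ### Comparing the two sums over words. -/

section Final

/-- The word of the letters of a sequence in `{0, …, m}`, as natural numbers. -/
def letters {n m : ℕ} (w : Fin n → Fin (m + 1)) : Fin n → ℕ := fun i => w i

/-- The monomial attached to a word. -/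
noncomputable def wordMonomial {n : ℕ} (w : Fin n → ℕ) : Var →₀ ℕ :=
  permMonomial (sortPerm w) fun i => w (sortPerm w i)

theorem letterWeight_eq_monomial {n : ℕ} (w : Fin n → ℕ) (i : Fin n) :
    letterWeight weightX weightY weightZ (w (sortPerm w i)) (smallerLeft w (sortPerm w i))
        (largerRight w (sortPerm w i)) =
      MvPowerSeries.monomial
        (Finsupp.single (typeVar i (sortPerm w i) (w (sortPerm w i))) 1)
        (u * if sortPerm w i = i then r else 1) := by
  have h := smallerLeft_add (π := sortPerm w) rfl i
  have hmon : ∀ (a : K) (v : Var), const a * MvPowerSeries.X v =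
      MvPowerSeries.monomial (Finsupp.single v 1) a := by
    intro a v
    rw [MvPowerSeries.X_def, const, ← MvPowerSeries.monomial_zero_eq_C_apply,
      MvPowerSeries.monomial_mul_monomial, zero_add, mul_one]
  simp only [letterWeight, typeVar, Fin.ext_iff]
  split_ifs <;> first
    | omega
    | (rw [mul_one]; exact hmon _ _)
    | (rw [mul_comm u r]; exact hmon _ _)

theorem prod_letterWeight {n : ℕ} (w : Fin n → ℕ) :
    ∏ i, letterWeight weightX weightY weightZ (w i) (smallerLeft w i) (largerRight w i) =
      MvPowerSeries.monomial (wordMonomial w) (u ^ n * r ^ fix (sortPerm w)) := by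
  rw [← Equiv.prod_comp (sortPerm w)]
  simp only [letterWeight_eq_monomial]
  rw [MvPowerSeries.prod_monomial, Finset.prod_mul_distrib, Finset.prod_const, Finset.card_univ,
    Fintype.card_fin, wordMonomial, permMonomial, Finset.prod_ite, Finset.prod_const,
    Finset.prod_const_one, mul_one]
  rfl

theorem eff_wordMonomial {n : ℕ} (w : Fin n → ℕ) :
    eff (wordMonomial w) = xdes (sortPerm w) :=
  eff_permMonomial (eq_sortPerm_iff.1 rfl)

theorem degree_wordMonomial {n : ℕ} (w : Fin n → ℕ) : (wordMonomial w).degree = n :=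
  degree_permMonomial _ _

/-- The image under `rho` of the contribution of a word to `S m`. -/
noncomputable def wordTerm (m : ℕ) (p : Σ n : ℕ, Fin n → Fin (m + 1)) : K :=
  u ^ p.1 * r ^ fix (sortPerm (letters p.2)) * s ^ xdes (sortPerm (letters p.2))

open scoped Classical in
theorem coeff_S_mul (m : ℕ) (M : Var →₀ ℕ) :
    MvPowerSeries.coeff M (S m) * s ^ eff M = ∑ w : Fin M.degree → Fin (m + 1),
      if wordMonomial (letters w) = M then wordTerm m ⟨M.degree, w⟩ else 0 := by
  rw [coeff_S, Finset.sum_mul]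
  refine Finset.sum_congr rfl fun w _ => ?_
  have := prod_letterWeight (letters w)
  rw [show (∏ i, letterWeight weightX weightY weightZ (w i)
    (smallerLeft (fun j => (w j : ℕ)) i) (largerRight (fun j => (w j : ℕ)) i)) = _ from this,
    MvPowerSeries.coeff_monomial]
  by_cases h : wordMonomial (letters w) = M
  · rw [if_pos h.symm, if_pos h, wordTerm, ← eff_wordMonomial, h]
  · rw [if_neg (Ne.symm h), if_neg h, zero_mul]

theorem coeff_u_pow_mul (n : ℕ) (a : K) {d : Fin 3 →₀ ℕ} (h : d 2 < n) :
    MvPowerSeries.coeff d (u ^ n * a) = 0 := by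
  classical
  rw [u, MvPowerSeries.X_pow_eq, MvPowerSeries.coeff_monomial_mul, if_neg]
  intro hle
  have := hle 2
  simp at this
  omega

/-- The factor `u ^ n` leaves only words of length at most `d 2` in the coefficient at `d`. -/
theorem summable_wordTerm (m : ℕ) : Summable (wordTerm m) := by
  rw [MvPowerSeries.WithPiTopology.summable_iff_summable_coeff]
  intro d
  refine summable_of_hasFiniteSupport ?_
  refine Set.Finite.subset (s := ((Finset.range (d 2 + 1)).sigma fun n =>
    (Finset.univ : Finset (Fin n → Fin (m + 1))) : Finset (Σ n : ℕ, Fin n → Fin (m + 1))))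
    (Finset.finite_toSet _) ?_
  intro p hp
  by_contra h
  apply hp
  simp only [wordTerm, mul_assoc]
  exact coeff_u_pow_mul _ _ (by simpa using h)

theorem hasSum_coeff_termF (m : ℕ) :
    HasSum (fun n => PowerSeries.coeff m (termF n)) (∑' p, wordTerm m p) := by
  refine (summable_wordTerm m).hasSum.sigma fun n => ?_
  rw [coeff_termF]
  exact hasSum_fintype _

/-- Group the words by their monomial. Its degree is the length of the word, so every fibre is
finite and sums to one coefficient of `S m` times its power of `s`. -/
theorem hasSum_coeff_S (m : ℕ) :
    HasSum (fun M => MvPowerSeries.coeff M (S m) * s ^ eff M) (∑' p, wordTerm m p) := by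
  classical
  let g : (Σ n : ℕ, Fin n → Fin (m + 1)) → (Var →₀ ℕ) := fun p => wordMonomial (letters p.2)
  have h := (Equiv.sigmaFiberEquiv g).hasSum_iff.2 (summable_wordTerm m).hasSum
  refine h.sigma fun M => ?_
  have hind : HasSum ({p | g p = M}.indicator (wordTerm m))
      (MvPowerSeries.coeff M (S m) * s ^ eff M) := by
    rw [coeff_S_mul]
    have := hasSum_sum_of_ne_finset_zero (f := {p | g p = M}.indicator (wordTerm m))
      (s := (Finset.univ : Finset (Fin M.degree → Fin (m + 1))).map
        (Function.Embedding.sigmaMk M.degree)) (L := SummationFilter.unconditional _) ?_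
    · rw [Finset.sum_map] at this
      convert this using 1
      exact Finset.sum_congr rfl fun w _ => by
        rw [Set.indicator_apply]; exact if_congr Iff.rfl rfl rfl
    · rintro ⟨n, w⟩ hp
      refine Set.indicator_of_notMem (fun hg => hp ?_) _
      have hn : M.degree = n := by
        rw [← show g ⟨n, w⟩ = M from hg]; exact degree_wordMonomial _
      subst hn
      simp
  exact hasSum_subtype_iff_indicator.2 hind

end Final

end CrossingDescents

theorem mainTheorem5 :
    Summable CrossingDescents.termF ∧
      ∃ h : ∀ m : ℕ, CrossingDescents.S m ∈ CrossingDescents.rhoDomain,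
        HasSum
          (fun m : ℕ => CrossingDescents.t ^ m *
            PowerSeries.C (CrossingDescents.rho ⟨CrossingDescents.S m, h m⟩))
          CrossingDescents.F := by
  have hF : Summable CrossingDescents.termF :=
    (PowerSeries.WithPiTopology.summable_iff_summable_coeff _).2 fun m =>
      (CrossingDescents.hasSum_coeff_termF m).summable
  refine ⟨hF, fun m => (CrossingDescents.hasSum_coeff_S m).summable, ?_⟩
  rw [PowerSeries.WithPiTopology.hasSum_iff_hasSum_coeff]
  intro d
  have h1 := (PowerSeries.WithPiTopology.hasSum_iff_hasSum_coeff _).1 hF.hasSum d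
  have h2 : PowerSeries.coeff d CrossingDescents.F = ∑' p, CrossingDescents.wordTerm d p :=
    h1.unique (CrossingDescents.hasSum_coeff_termF d)
  have h3 : CrossingDescents.rho ⟨CrossingDescents.S d,
      (CrossingDescents.hasSum_coeff_S d).summable⟩ = ∑' p, CrossingDescents.wordTerm d p :=
    (CrossingDescents.hasSum_coeff_S d).tsum_eq
  rw [h2, ← h3]
  -- Only `m = d` contributes to the coefficient of `t ^ d`.
  convert hasSum_single d ?_ using 1
  · simp [CrossingDescents.t]
  · intro m hm
    rw [CrossingDescents.t, PowerSeries.coeff_X_pow_mul', PowerSeries.coeff_C]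
    split_ifs <;> first | rfl | omega
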